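/- Let $0<q<1$ and let $n\ge 0$ be an integer. Let $\Lambda_n=\{\lambda\in\mathbb{Z}^n\mid\lambda_1\ge\cdots\ge\lambda_n\}$, and let $\mathcal{F}(\Lambda_n)$ be the space of all functions $f:\Lambda_n\to\mathbb{C}$. For $\lambda\in\Lambda_n$ and $l\in\mathbb{Z}$ let $m_l(\lambda)$ be the number of components of $\lambda$ equal to $l$; write $\beta_l^*\lambda\in\Lambda_{n+1}$ for the point obtained by inserting a component $l$ in $\lambda$ and, if $m_l(\lambda)>0$, write $\beta_l\lambda\in\Lambda_{n-1}$ for the point obtained by deleting a component $l$. Put $[m]=\frac{1-q^m}{1-q}$ and $[m]!=[m][m-1]\cdots[1]$, with $[0]!=1$. For $f\in\mathcal{F}(\Lambda_n)$ define $\beta_lf\in\mathcal{F}(\Lambda_{n-1})$ by $(\beta_lf)(\lambda)=f(\beta_l^*\lambda)$ (and $\beta_lf=0$ if $n=0$), and $\beta_l^*f\in\mathcal{F}(\Lambda_{n+1})$ by $(\beta_l^*f)(\lambda)=[m_l(\lambda)]f(\beta_l\lambda)$ if $m_l(\lambda)>0$ and $(\beta_l^*f)(\lambda)=0$ otherwise.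 The hopping operators $a_l=\beta_{l+1}^*\beta_l$ and $a_l^*=\beta_{l+1}\beta_l^*$ map $\mathcal{F}(\Lambda_n)$ into itself. For an integer $r\geq 1$ define operators on $\mathcal{F}(\Lambda_n)$ by $$H_r=\sum_{|\eta|=r}\frac{1}{[\eta_1]!\cdots[\eta_p]!}\sum_{c}\ \sum_{l_1<\cdots<l_p}a_{l_1}^{c_1}\cdots a_{l_p}^{c_p},\qquad H_r^*=\sum_{|\eta|=r}\frac{1}{[\eta_1]!\cdots[\eta_p]!}\sum_{c}\ \sum_{l_1>\cdots>l_p}(a_{l_1}^*)^{c_1}\cdots (a_{l_p}^*)^{c_p},$$ where $\eta=(\eta_1,\ldots,\eta_p)$ runs over the partitions of $r$ (into positive parts), $c=(c_1,\ldots,c_p)$ runs over the distinct reorderings of $\eta$, and $l_1,\ldots,l_p$ run over $\mathbb{Z}$; let also $\mathrm{H}_q=\sum_{l\in\mathbb{Z}}(a_l+a_l^*)$. (Evaluated at a given point of $\Lambda_n$, these sums have only finitely many nonzero terms.) Let $\xi\in\mathbb{R}^n$ with $\pi>\xi_1>\xi_2>\cdots>\xi_n>-\pi$, and let $\phi_\xi\in\mathcal{F}(\Lambda_n)$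 be the Hall–Littlewood function $$\phi_\xi(\lambda)=\sum_{\sigma\in S_n}C(\xi_\sigma)e^{i\lambda\cdot\xi_\sigma},\qquad C(\xi)=\prod_{1\le j<k\le n}\frac{1-qe^{i(\xi_k-\xi_j)}}{1-e^{i(\xi_k-\xi_j)}},\qquad \xi_\sigma=(\xi_{\sigma_1},\ldots,\xi_{\sigma_n}).$$ Then $\phi_\xi$ is a joint eigenfunction of these operators: $\phi_\xi\neq0$, $$H_r\phi_\xi=e_r(e^{-i\xi_1},\ldots,e^{-i\xi_n})\,\phi_\xi\quad\text{and}\quad H_r^*\phi_\xi=e_r(e^{i\xi_1},\ldots,e^{i\xi_n})\,\phi_\xi\qquad(r=1,\ldots,n),$$ where $e_r$ is the $r$th elementary symmetric polynomial, and $\mathrm{H}_q\phi_\xi=\Bigl(2\sum_{j=1}^n\cos\xi_j\Bigr)\phi_\xi$. -/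

import Mathlib

open scoped Real

namespace QBoson

noncomputable section

/-- The set `Λ_n` of weakly decreasing `n`-tuples of integers. -/
abbrev Dominant (n : ℕ) : Type := {x : Fin n → ℤ // Antitone x}

/-- The space `F(Λ_n)` of all complex functions on `Λ_n`. -/
abbrev Fun (n : ℕ) : Type := Dominant n → ℂ

/-- The multiplicity `m_l(x)`: the number of components of `x` that are equal to `l`. -/
def mult {n : ℕ} (l : ℤ) (x : Dominant n) : ℕ :=
  (Finset.univ.filter fun j => x.1 j = l).card

/-- The number of components of `x` that exceed `l`. -/
def pos {n : ℕ} (l : ℤ) (x : Dominant n) : ℕ :=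
  (Finset.univ.filter fun j => l < x.1 j).card

theorem pos_le {n : ℕ} (l : ℤ) (x : Dominant n) : pos l x ≤ n := by
  simpa [pos] using Finset.card_filter_le (Finset.univ : Finset (Fin n)) (fun j => l < x.1 j)

theorem lt_pos_iff {n : ℕ} (l : ℤ) (x : Dominant n) (j : Fin n) :
    j.1 < pos l x ↔ l < x.1 j := by
  constructor
  · intro h
    by_contra hc
    have hsub : (Finset.univ.filter fun i => l < x.1 i) ⊆ Finset.Iio j := by
      intro i hi
      simp only [Finset.mem_filter, Finset.mem_univ, true_and] at hi
      rw [Finset.mem_Iio]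
      by_contra hij
      exact hc (lt_of_lt_of_le hi (x.2 (not_lt.mp hij)))
    have h2 := Finset.card_le_card hsub
    rw [Fin.card_Iio] at h2
    exact absurd h (not_lt.mpr h2)
  · intro h
    have hsub : Finset.Iic j ⊆ (Finset.univ.filter fun i => l < x.1 i) := by
      intro i hi
      rw [Finset.mem_Iic] at hi
      simp only [Finset.mem_filter, Finset.mem_univ, true_and]
      exact lt_of_lt_of_le h (x.2 hi)
    have h2 := Finset.card_le_card hsub
    rw [Fin.card_Iic] at h2
    exact h2

/-- `β*_l x`: the point of `Λ_{n+1}` obtained from `x` by inserting an additional component with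
value `l` (after all components that exceed `l`). -/
def insertPart {n : ℕ} (l : ℤ) (x : Dominant n) : Dominant (n + 1) :=
  ⟨Fin.insertNth (⟨pos l x, Nat.lt_succ_of_le (pos_le l x)⟩ : Fin (n + 1)) l x.1, by
    intro i j hij
    set p : Fin (n + 1) := ⟨pos l x, Nat.lt_succ_of_le (pos_le l x)⟩ with hp
    induction i using Fin.succAboveCases p with
    | x =>
      induction j using Fin.succAboveCases p with
      | x => simp
      | p j =>
        simp only [Fin.insertNth_apply_same, Fin.insertNth_apply_succAbove]
        have h1 : p ≤ j.castSucc := by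
          by_contra hc
          rw [Fin.succAbove_of_castSucc_lt _ _ (not_le.mp hc)] at hij
          exact hc hij
        have h2 : ¬ j.1 < pos l x := by
          have h3 : pos l x ≤ j.1 := h1
          omega
        rw [lt_pos_iff] at h2
        exact not_lt.mp h2
    | p i =>
      induction j using Fin.succAboveCases p with
      | x =>
        simp only [Fin.insertNth_apply_same, Fin.insertNth_apply_succAbove]
        have h1 : i.castSucc < p := by
          by_contra hc
          rw [Fin.succAbove_of_le_castSucc _ _ (not_lt.mp hc)] at hij
          have h3 : p.1 ≤ i.1 := not_lt.mp hc
          have h4 : i.1 + 1 ≤ p.1 := hij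
          omega
        have h2 : i.1 < pos l x := h1
        rw [lt_pos_iff] at h2
        exact h2.le
      | p j =>
        simp only [Fin.insertNth_apply_succAbove]
        exact x.2 ((Fin.strictMono_succAbove p).le_iff_le.mp hij)⟩

/-- `β_l x`: the point of `Λ_n` obtained from `x` by deleting a component with value `l`
(the first one), assuming `m_l(x) > 0`. -/
def deletePart {n : ℕ} (l : ℤ) (x : Dominant (n + 1)) (h : 0 < mult l x) : Dominant n :=
  ⟨fun i => x.1 (((Finset.univ.filter fun j => x.1 j = l).min'
      (Finset.card_pos.mp h)).succAbove i),
    fun _ _ hij => x.2 ((Fin.strictMono_succAbove _).monotone hij)⟩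

/-- The `q`-number `[m] = (1 - q^m) / (1 - q)`. -/
def qNum (q : ℝ) (m : ℕ) : ℝ := (1 - q ^ m) / (1 - q)

/-- The `q`-factorial `[m]! = [m] [m-1] ⋯ [1]`. -/
def qFact (q : ℝ) (m : ℕ) : ℝ := ∏ k ∈ Finset.Icc 1 m, qNum q k

/-- The annihilation operator `β_l : F(Λ_{n+1}) → F(Λ_n)`, `(β_l f)(x) = f(β*_l x)`. -/
def annihilate {n : ℕ} (l : ℤ) : Fun (n + 1) →ₗ[ℂ] Fun n where
  toFun f x := f (insertPart l x)
  map_add' _ _ := rfl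
  map_smul' _ _ := rfl

/-- The creation operator `β*_l : F(Λ_n) → F(Λ_{n+1})`, with `(β*_l f)(x) = [m_l(x)] f(β_l x)`
if `m_l(x) > 0` and `(β*_l f)(x) = 0` otherwise. -/
def create {n : ℕ} (q : ℝ) (l : ℤ) : Fun n →ₗ[ℂ] Fun (n + 1) where
  toFun f x := if h : 0 < mult l x then (qNum q (mult l x) : ℂ) * f (deletePart l x h) else 0
  map_add' f g := by
    funext x
    by_cases h : 0 < mult l x
    · simp [h, mul_add]
    · simp [h]
  map_smul' c f := by
    funext x
    by_cases h : 0 < mult l x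
    · simp [h, mul_left_comm]
    · simp [h]

/-- The hopping operator `a_l = β*_{l+1} β_l` on `F(Λ_n)`
(it vanishes for `n = 0`, since `β_l` vanishes on `F(Λ_0)`). -/
def hop (q : ℝ) (l : ℤ) : (n : ℕ) → Module.End ℂ (Fun n)
  | 0 => 0
  | _ + 1 => create q (l + 1) ∘ₗ annihilate l

/-- The hopping operator `a*_l = β_{l+1} β*_l` on `F(Λ_n)`. -/
def hopStar (q : ℝ) (l : ℤ) (n : ℕ) : Module.End ℂ (Fun n) :=
  annihilate (l + 1) ∘ₗ create q l

/-- A family of operators on `F(Λ_n)` is locally finite if, at each point `x`, only finitely many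
of its members contribute. -/
def LocallyFinite {n : ℕ} {ι : Type} (T : ι → Module.End ℂ (Fun n)) : Prop :=
  ∀ x : Dominant n, {i | ∃ f : Fun n, T i f x ≠ 0}.Finite

theorem LocallyFinite.support {n : ℕ} {ι : Type} {T : ι → Module.End ℂ (Fun n)}
    (hT : LocallyFinite T) (f : Fun n) (x : Dominant n) :
    (Function.support fun i => T i f x).Finite :=
  (hT x).subset fun _ hi => ⟨f, hi⟩

/-- The pointwise sum `(∑ i, T i f)(x)` of a locally finite family of operators on `F(Λ_n)`. -/
def opSum {n : ℕ} {ι : Type} (T : ι → Module.End ℂ (Fun n)) (hT : LocallyFinite T) :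
    Module.End ℂ (Fun n) where
  toFun f x := ∑ᶠ i, T i f x
  map_add' f g := by
    funext x
    simp only [map_add, Pi.add_apply]
    exact finsum_add_distrib (hT.support f x) (hT.support g x)
  map_smul' c f := by
    funext x
    simp only [map_smul, Pi.smul_apply, RingHom.id_apply]
    exact (smul_finsum c _).symm

/-- The ordered monomial `X_{l_1}^{c_1} ⋯ X_{l_p}^{c_p}`. -/
def monomial {n : ℕ} (X : ℤ → Module.End ℂ (Fun n)) (c : List ℕ) (l : Fin c.length → ℤ) :
    Module.End ℂ (Fun n) :=
  (List.ofFn fun k => X (l k) ^ c.get k).prod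

/-- If the value of `X l f` at each point depends on `f` at a single point only, then for given
positive exponents only finitely many monomials contribute at each point. -/
theorem monomial_finite {n : ℕ} (X : ℤ → Module.End ℂ (Fun n)) (hX : LocallyFinite X)
    (hloc : ∀ l x, ∃ y, ∀ f : Fun n, f y = 0 → X l f x = 0) (c : List ℕ) (hc : ∀ m ∈ c, 0 < m) :
    ∀ x : Dominant n, {l | ∃ f : Fun n, monomial X c l f x ≠ 0}.Finite := by
  have hpow : ∀ (m : ℕ) (l : ℤ) (x : Dominant n),
      ∃ y, ∀ f : Fun n, f y = 0 → (X l ^ m) f x = 0 := by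
    intro m l
    induction m with
    | zero => exact fun x => ⟨x, fun f hf => by simpa using hf⟩
    | succ m ih =>
      intro x
      obtain ⟨y, hy⟩ := hloc l x
      obtain ⟨z, hz⟩ := ih y
      refine ⟨z, fun f hf => ?_⟩
      rw [pow_succ', Module.End.mul_apply]
      exact hy _ (hz f hf)
  induction c with
  | nil =>
    intro x
    have : Subsingleton (Fin ([] : List ℕ).length → ℤ) :=
      ⟨fun a b => funext fun i => i.elim0⟩
    exact Set.toFinite _
  | cons m c ih =>
    intro x
    have hm : 0 < m := hc m (by simp)
    have ih' := ih fun k hk => hc k (by simp [hk])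
    choose y hy using fun l => hpow m l x
    have hfin : (⋃ l₀ ∈ {l₀ | ∃ f : Fun n, X l₀ f x ≠ 0},
        (fun l' : Fin c.length → ℤ => (Fin.cons l₀ l' : Fin (c.length + 1) → ℤ)) ''
          {l' | ∃ f : Fun n, monomial X c l' f (y l₀) ≠ 0}).Finite :=
      (hX x).biUnion fun l₀ _ => (ih' (y l₀)).image _
    refine hfin.subset ?_
    rintro l ⟨f, hf⟩
    have hmul : monomial X (m :: c) l =
        X (l 0) ^ m * monomial X c (fun k => l (Fin.succ k)) := by
      simp [monomial, List.ofFn_succ]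
    rw [hmul, Module.End.mul_apply] at hf
    simp only [Set.mem_iUnion]
    refine ⟨l 0, ?_, fun k => l (Fin.succ k), ⟨f, fun h0 => hf (hy _ _ h0)⟩, ?_⟩
    · obtain ⟨k, rfl⟩ := Nat.exists_eq_succ_of_ne_zero hm.ne'
      rw [pow_succ', Module.End.mul_apply] at hf
      exact ⟨_, hf⟩
    · exact Fin.cons_self_tail (α := fun _ => ℤ) l

theorem create_eq_zero {n : ℕ} (q : ℝ) (l : ℤ) (f : Fun n) (x : Dominant (n + 1))
    (h : ∀ j, x.1 j ≠ l) : create q l f x = 0 := by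
  have h0 : ¬ 0 < mult l x := by
    rw [mult, Finset.card_pos]
    rintro ⟨j, hj⟩
    exact h j (by simpa using hj)
  simp [create, h0]

theorem create_local {n : ℕ} (q : ℝ) (l : ℤ) (x : Dominant (n + 1)) (z : Dominant n) :
    ∃ y, ∀ f : Fun n, f y = 0 → create q l f x = 0 := by
  by_cases h : 0 < mult l x
  · exact ⟨deletePart l x h, fun f hf => by simp [create, h, hf]⟩
  · exact ⟨z, fun f _ => by simp [create, h]⟩

theorem hop_locallyFinite (q : ℝ) (n : ℕ) : LocallyFinite fun l => hop q l n := by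
  intro x
  cases n with
  | zero => simp [hop]
  | succ n =>
    refine (Set.finite_range fun j => x.1 j - 1).subset ?_
    rintro l ⟨f, hf⟩
    by_contra hc
    refine hf (create_eq_zero q (l + 1) _ x fun j hj => hc ⟨j, ?_⟩)
    simp [hj]

theorem hopStar_locallyFinite (q : ℝ) (n : ℕ) : LocallyFinite fun l => hopStar q l n := by
  intro x
  refine (Set.finite_range fun j => x.1 j).subset ?_
  rintro l ⟨f, hf⟩
  by_contra hc
  refine hf (create_eq_zero q l _ (insertPart (l + 1) x) fun j hj => ?_)
  rw [insertPart] at hj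
  dsimp only at hj
  generalize (⟨pos (l + 1) x, Nat.lt_succ_of_le (pos_le (l + 1) x)⟩ : Fin (n + 1)) = p at hj
  induction j using Fin.succAboveCases p with
  | x => simp at hj
  | p j => exact hc ⟨j, by simpa using hj⟩

theorem hop_local (q : ℝ) (n : ℕ) (l : ℤ) (x : Dominant n) :
    ∃ y, ∀ f : Fun n, f y = 0 → hop q l n f x = 0 := by
  cases n with
  | zero => exact ⟨x, fun f _ => by simp [hop]⟩
  | succ n =>
    obtain ⟨j⟩ : Nonempty (Dominant n) := ⟨⟨fun _ => 0, fun _ _ _ => le_rfl⟩⟩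
    obtain ⟨y, hy⟩ := create_local q (l + 1) x j
    exact ⟨insertPart l y, fun f hf => hy (annihilate l f) hf⟩

theorem hopStar_local (q : ℝ) (n : ℕ) (l : ℤ) (x : Dominant n) :
    ∃ y, ∀ f : Fun n, f y = 0 → hopStar q l n f x = 0 := by
  obtain ⟨y, hy⟩ := create_local q l (insertPart (l + 1) x) x
  exact ⟨y, fun f hf => hy f hf⟩

/-- The finite set of all distinct compositions obtained by reordering the parts of `η`. -/
def reorderings {r : ℕ} (η : r.Partition) : Finset (List ℕ) := η.parts.lists.toFinset

theorem mem_reorderings {r : ℕ} (η : r.Partition) (c : List ℕ) :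
    c ∈ reorderings η ↔ (c : Multiset ℕ) = η.parts := by
  rw [reorderings, Multiset.mem_toFinset, Multiset.mem_lists_iff]
  exact eq_comm

theorem reordering_pos {r : ℕ} (η : r.Partition) (c : {c // c ∈ reorderings η}) :
    ∀ m ∈ c.1, 0 < m := by
  intro m hm
  have h := (mem_reorderings η c.1).mp c.2
  exact η.parts_pos (by rw [← h]; simpa using hm)

theorem hop_monomial_locallyFinite (q : ℝ) (n : ℕ) {r : ℕ} (η : r.Partition)
    (c : {c // c ∈ reorderings η}) :
    LocallyFinite fun l : {l : Fin c.1.length → ℤ // StrictMono l} =>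
      monomial (fun k => hop q k n) c.1 l.1 := fun x =>
  Set.Finite.preimage (f := Subtype.val) Subtype.val_injective.injOn
    (monomial_finite _ (hop_locallyFinite q n) (hop_local q n) c.1 (reordering_pos η c) x)

theorem hopStar_monomial_locallyFinite (q : ℝ) (n : ℕ) {r : ℕ} (η : r.Partition)
    (c : {c // c ∈ reorderings η}) :
    LocallyFinite fun l : {l : Fin c.1.length → ℤ // StrictAnti l} =>
      monomial (fun k => hopStar q k n) c.1 l.1 := fun x =>
  Set.Finite.preimage (f := Subtype.val) Subtype.val_injective.injOn
    (monomial_finite _ (hopStar_locallyFinite q n) (hopStar_local q n) c.1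
      (reordering_pos η c) x)

/-- `m_η(a)` on `F(Λ_n)`: the sum of `a_{l_1}^{c_1} ⋯ a_{l_p}^{c_p}` over all distinct
reorderings `c` of the parts of `η` and all integers `l_1 < ⋯ < l_p`. -/
def monomialSym (q : ℝ) (n : ℕ) {r : ℕ} (η : r.Partition) : Module.End ℂ (Fun n) :=
  ∑ c ∈ (reorderings η).attach,
    opSum (fun l : {l : Fin c.1.length → ℤ // StrictMono l} =>
      monomial (fun k => hop q k n) c.1 l.1) (hop_monomial_locallyFinite q n η c)

/-- `m_η(a*)` on `F(Λ_n)`: the sum of `(a*_{l_1})^{c_1} ⋯ (a*_{l_p})^{c_p}` over all distinct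
reorderings `c` of the parts of `η` and all integers `l_1 > ⋯ > l_p`. -/
def monomialSymStar (q : ℝ) (n : ℕ) {r : ℕ} (η : r.Partition) : Module.End ℂ (Fun n) :=
  ∑ c ∈ (reorderings η).attach,
    opSum (fun l : {l : Fin c.1.length → ℤ // StrictAnti l} =>
      monomial (fun k => hopStar q k n) c.1 l.1) (hopStar_monomial_locallyFinite q n η c)

/-- `[η]! = [η_1]! ⋯ [η_p]!`. -/
def partitionFact (q : ℝ) {r : ℕ} (η : r.Partition) : ℝ := (η.parts.map (qFact q)).prod

/-- `H_r = ∑_{|η| = r} m_η(a) / [η]!` on `F(Λ_n)`. -/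
def hamR (q : ℝ) (n r : ℕ) : Module.End ℂ (Fun n) :=
  ∑ η : r.Partition, ((partitionFact q η : ℂ)⁻¹) • monomialSym q n η

/-- `H*_r = ∑_{|η| = r} m_η(a*) / [η]!` on `F(Λ_n)`. -/
def hamRStar (q : ℝ) (n r : ℕ) : Module.End ℂ (Fun n) :=
  ∑ η : r.Partition, ((partitionFact q η : ℂ)⁻¹) • monomialSymStar q n η

theorem hop_add_locallyFinite (q : ℝ) (n : ℕ) :
    LocallyFinite fun l => hop q l n + hopStar q l n := by
  intro x
  refine ((hop_locallyFinite q n x).union (hopStar_locallyFinite q n x)).subset ?_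
  rintro l ⟨f, hf⟩
  by_contra hc
  simp only [Set.mem_union, Set.mem_ofPred_eq, not_or, not_exists, not_not] at hc
  exact hf (by simp [hc.1 f, hc.2 f])

/-- The `q`-boson Hamiltonian `H_q = ∑_l (a_l + a*_l)` on `F(Λ_n)`. -/
def hamiltonian (q : ℝ) (n : ℕ) : Module.End ℂ (Fun n) :=
  opSum (fun l : ℤ => hop q l n + hopStar q l n) (hop_add_locallyFinite q n)

/-- The open fundamental alcove `π > ξ_1 > ⋯ > ξ_n > -π`. -/
def alcove (n : ℕ) : Set (Fin n → ℝ) :=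
  {ξ | StrictAnti ξ ∧ ∀ j, -π < ξ j ∧ ξ j < π}

/-- `C(ξ) = ∏_{j<k} (1 - q e^{i(ξ_k - ξ_j)}) / (1 - e^{i(ξ_k - ξ_j)})`. -/
def cFun (q : ℝ) {n : ℕ} (ξ : Fin n → ℝ) : ℂ :=
  ∏ j : Fin n, ∏ k ∈ Finset.Ioi j,
    (1 - (q : ℂ) * Complex.exp (Complex.I * ((ξ k - ξ j : ℝ) : ℂ))) /
      (1 - Complex.exp (Complex.I * ((ξ k - ξ j : ℝ) : ℂ)))

/-- The Hall-Littlewood function `φ_ξ(x) = ∑_σ C(ξ_σ) e^{i x·ξ_σ}`. -/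
def hallLittlewood (q : ℝ) {n : ℕ} (ξ : Fin n → ℝ) : Fun n := fun x =>
  ∑ σ : Equiv.Perm (Fin n), cFun q (fun j => ξ (σ j)) *
    Complex.exp (Complex.I * ((∑ j, (x.1 j : ℝ) * ξ (σ j) : ℝ) : ℂ))

end

end QBoson

/-! View a function on `Λ_n` as a function of the multiset `M` of components. The operator `a_l`
lowers one component `l + 1` to `l`, weighted by `[m]` with `m` the multiplicity of `l + 1`. In an
ordered monomial with increasing labels the leftmost factor changes the argument first, and it never
touches the components that later factors lower. All weights are therefore falling `q`-factorials of
the original multiplicities. Division by `[η]!` turns them into `q`-binomials, so `H_r` sums over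
the submultisets `T ≤ M` of size `r`, lowering all of `T` by one with weight `stripCoeff`
(`ActsByLowering.sum_monomials`).

The same sum comes from the plane waves. Multiplying `∏ y_j ^ x_j` by `e_r(y⁻¹)` lowers the
exponents at `r` positions in all possible ways (`sum_lowerSum_wave`), which may produce unsorted
lists. The Hall-Littlewood sum extends to arbitrary integer lists, and there exchanging an adjacent
pair `a, a + 1` for `a + 1, a` costs a factor `q` (`hallLittlewoodList_straight`). This is an
identity for the `c`-function, seen by pairing `σ` with `σ` times the adjacent transposition.
Sorting the lowered lists back then yields powers of `q` that add up to the same `q`-binomials, by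
the `q`-Pascal rule (`lowerSum_eq`).

The statement for `H_r^*` follows by the reflection that negates and reverses both components and
wave vector, which exchanges raising with lowering. The Hamiltonian combines the two cases `r = 1`.
Nonvanishing follows from the linear independence of distinct characters on the monoid of dominant
tuples, since the coefficients `C(ξ_σ)` are nonzero. -/

namespace QBoson

noncomputable section

/-! ### `q`-binomial coefficients -/

/-- The falling `q`-factorial `[m] [m-1] ⋯ [m-c+1]`. -/
def qFall (q : ℝ) (m c : ℕ) : ℝ := ∏ i ∈ Finset.range c, qNum q (m - i)

/-- The `q`-binomial coefficient. -/
def qBinom (q : ℝ) (m c : ℕ) : ℝ := qFall q m c / qFact q c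

@[simp] theorem qNum_zero (q : ℝ) : qNum q 0 = 0 := by simp [qNum]

theorem qNum_pos {q : ℝ} (hq0 : 0 < q) (hq1 : q < 1) {m : ℕ} (hm : 0 < m) : 0 < qNum q m :=
  div_pos (sub_pos.2 (pow_lt_one₀ hq0.le hq1 hm.ne')) (sub_pos.2 hq1)

theorem qFact_pos {q : ℝ} (hq0 : 0 < q) (hq1 : q < 1) (m : ℕ) : 0 < qFact q m :=
  Finset.prod_pos fun _ hk => qNum_pos hq0 hq1 (Finset.mem_Icc.1 hk).1

@[simp] theorem qFall_zero (q : ℝ) (m : ℕ) : qFall q m 0 = 1 := by simp [qFall]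

@[simp] theorem qFact_zero (q : ℝ) : qFact q 0 = 1 := by simp [qFact]

@[simp] theorem qBinom_zero (q : ℝ) (m : ℕ) : qBinom q m 0 = 1 := by simp [qBinom]

theorem qFact_succ (q : ℝ) (m : ℕ) : qFact q (m + 1) = qFact q m * qNum q (m + 1) := by
  rw [qFact, Finset.prod_Icc_succ_top (by omega), qFact]

theorem qFall_succ (q : ℝ) (m c : ℕ) : qFall q m (c + 1) = qFall q m c * qNum q (m - c) := by
  rw [qFall, Finset.prod_range_succ, qFall]

theorem qFall_succ_left (q : ℝ) (m c : ℕ) :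
    qFall q m (c + 1) = qNum q m * qFall q (m - 1) c := by
  rw [qFall, Finset.prod_range_succ', mul_comm, qFall]
  congr 1
  exact Finset.prod_congr rfl fun i _ => by rw [Nat.sub_sub, add_comm]

/-- The product contains the factor `[m - m] = [0] = 0`, so submultisets that do not fit drop out of
all later sums by themselves. -/
theorem qFall_eq_zero (q : ℝ) {m c : ℕ} (h : m < c) : qFall q m c = 0 :=
  Finset.prod_eq_zero (Finset.mem_range.2 h) (by simp)

theorem qBinom_eq_zero (q : ℝ) {m c : ℕ} (h : m < c) : qBinom q m c = 0 := by
  simp [qBinom, qFall_eq_zero q h]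

theorem qNum_add {q : ℝ} (hq1 : q < 1) (a b : ℕ) :
    qNum q (a + b) = qNum q a + q ^ a * qNum q b := by
  have : (1 - q) ≠ 0 := (sub_pos.2 hq1).ne'
  simp only [qNum]
  field_simp
  ring

/-- This `q`-Pascal rule drives the induction in `lowerSum_eq`. It comes from `[m+1] = [m-s] +
q^(m-s) [s+1]`; for `m < s` the subtraction is truncated, but all three coefficients vanish. -/
theorem qBinom_succ_succ {q : ℝ} (hq0 : 0 < q) (hq1 : q < 1) (m s : ℕ) :
    qBinom q (m + 1) (s + 1) = qBinom q m (s + 1) + q ^ (m - s) * qBinom q m s := by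
  rcases lt_or_ge m s with h | h
  · rw [qBinom_eq_zero q (by omega), qBinom_eq_zero q (by omega), qBinom_eq_zero q h]
    simp
  · have h1 := (qFact_pos hq0 hq1 s).ne'
    have h2 := (qNum_pos hq0 hq1 s.succ_pos).ne'
    have h3 : qNum q (m + 1) = qNum q (m - s) + q ^ (m - s) * qNum q (s + 1) := by
      rw [← qNum_add hq1]
      congr 1
      omega
    simp only [qBinom, qFall_succ_left q (m + 1), Nat.add_sub_cancel, qFall_succ q m, qFact_succ, h3]
    field_simp

theorem qBinom_one_right {q : ℝ} (hq1 : q < 1) (m : ℕ) : qBinom q m 1 = qNum q m := by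
  have : (1 - q) ≠ 0 := (sub_pos.2 hq1).ne'
  have h1 : qNum q 1 = 1 := by simp [qNum, this]
  simp [qBinom, qFall, qFact, h1]

/-- The product of the `q`-binomial coefficients of the multiplicities in `T` relative to `M`. -/
def stripCoeff (q : ℝ) (M T : Multiset ℤ) : ℝ :=
  ∏ b ∈ T.toFinset, qBinom q (M.count b) (T.count b)

theorem stripCoeff_eq_prod (q : ℝ) (M : Multiset ℤ) {T : Multiset ℤ} {s : Finset ℤ}
    (h : T.toFinset ⊆ s) : stripCoeff q M T = ∏ b ∈ s, qBinom q (M.count b) (T.count b) :=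
  Finset.prod_subset h fun b _ hb => by
    rw [Multiset.count_eq_zero_of_notMem (s := T) (by simpa using hb), qBinom_zero]

theorem stripCoeff_eq_zero (q : ℝ) {M T : Multiset ℤ} (h : ¬ T ≤ M) : stripCoeff q M T = 0 := by
  rw [Multiset.le_iff_count] at h
  push Not at h
  obtain ⟨b, hb⟩ := h
  refine Finset.prod_eq_zero (i := b) ?_ (qBinom_eq_zero q hb)
  rw [Multiset.mem_toFinset, ← Multiset.count_pos]
  omega

/-! ### Straightening -/

/-- The multiset obtained from `M` by lowering by one the entries in `T`. -/
def lower (M T : Multiset ℤ) : Multiset ℤ := M - T + T.map (· - 1)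

theorem count_map_sub_one (T : Multiset ℤ) (b : ℤ) :
    (T.map (· - 1)).count b = T.count (b + 1) := by
  have := Multiset.count_map_eq_count' (fun x : ℤ => x - 1) T sub_left_injective (b + 1)
  simpa using this

/-- The decreasing list of the elements of `M`. -/
abbrev sortDesc (M : Multiset ℤ) : List ℤ := M.sort (· ≥ ·)

theorem sortDesc_eq {L : List ℤ} {M : Multiset ℤ} (hL : L.Pairwise (· ≥ ·)) (h : (L : Multiset ℤ) = M) :
    sortDesc M = L := by
  refine List.Perm.eq_of_pairwise (le := (· ≥ ·)) (fun a b _ _ h1 h2 => le_antisymm h2 h1)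
    (Multiset.pairwise_sort _ _) hL ?_
  rw [← Multiset.coe_eq_coe, Multiset.sort_eq, h]

theorem sortDesc_cons {a : ℤ} {M : Multiset ℤ} (h : ∀ b ∈ M, b ≤ a) :
    sortDesc (a ::ₘ M) = a :: sortDesc M := by
  refine sortDesc_eq (List.pairwise_cons.2 ⟨fun b hb => h b ?_, Multiset.pairwise_sort _ _⟩) ?_
  · simpa using hb
  · rw [← Multiset.cons_coe, Multiset.sort_eq]

/-- A function on lists of length `n` is straight if it picks up a factor `q` when an adjacent
pair `a, a + 1` is put into decreasing order. -/
def Straight (q : ℝ) (n : ℕ) (F : List ℤ → ℂ) : Prop :=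
  ∀ (u : List ℤ) (a : ℤ) (v : List ℤ), u.length + v.length + 2 = n →
    F (u ++ a :: (a + 1) :: v) = q * F (u ++ (a + 1) :: a :: v)

theorem Straight.cons {q : ℝ} {n : ℕ} {F : List ℤ → ℂ} (hF : Straight q (n + 1) F) (b : ℤ) :
    Straight q n fun L => F (b :: L) := fun u a v h => by
  simpa using hF (b :: u) a v (by simp; omega)

/-- The entry `a - 1` moves to the right past the copies of `a` one at a time, and each exchange
contributes one factor `q`. -/
theorem Straight.replicate {q : ℝ} {n : ℕ} {F : List ℤ → ℂ} (hF : Straight q n F) (a : ℤ)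
    (k : ℕ) (R : List ℤ) (h : k + R.length + 1 = n) :
    F ((a - 1) :: (List.replicate k a ++ R)) = q ^ k * F (List.replicate k a ++ (a - 1) :: R) := by
  induction k generalizing n F with
  | zero => simp
  | succ k ih =>
    obtain ⟨n, rfl⟩ : ∃ m, n = m + 1 := ⟨n - 1, by omega⟩
    have h1 := hF [] (a - 1) (List.replicate k a ++ R) (by simp; omega)
    have h2 := ih (hF.cons a) (by omega)
    simp only [sub_add_cancel, List.nil_append] at h1
    rw [List.replicate_succ, List.cons_append, h1, h2, pow_succ']
    simp [mul_assoc]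

/-- The sum of `F` over all ways to lower by one some entries of a list, the multiset of the
entries that are lowered being `T`. -/
def lowerSum : (List ℤ → ℂ) → List ℤ → Multiset ℤ → ℂ
  | F, [], T => if T = 0 then F [] else 0
  | F, a :: L, T => lowerSum (fun K => F (a :: K)) L T +
      if a ∈ T then lowerSum (fun K => F ((a - 1) :: K)) L (T.erase a) else 0

theorem mem_lower_le {M T : Multiset ℤ} {a b : ℤ} (hM : ∀ c ∈ M, c ≤ a) (hT : T ≤ M)
    (hb : b ∈ lower M T) : b ≤ a := by
  rw [lower, Multiset.mem_add, Multiset.mem_map] at hb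
  rcases hb with hb | ⟨c, hc, rfl⟩
  · exact hM b (Multiset.mem_of_le (Multiset.sub_le_self _ _) hb)
  · have := hM c (Multiset.mem_of_le hT hc)
    omega

theorem sortDesc_eq_replicate_append {M : Multiset ℤ} {a : ℤ} (h : ∀ b ∈ M, b ≤ a) :
    sortDesc M = List.replicate (M.count a) a ++ sortDesc (M.filter (· < a)) := by
  refine sortDesc_eq ?_ ?_
  · rw [List.pairwise_append]
    refine ⟨?_, Multiset.pairwise_sort _ _, fun b hb c hc => ?_⟩
    · simp [List.pairwise_replicate]
    · have h1 := List.eq_of_mem_replicate hb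
      simp only [Multiset.mem_sort, Multiset.mem_filter] at hc
      omega
  · rw [← Multiset.coe_add, Multiset.sort_eq, Multiset.coe_replicate]
    ext b
    rw [Multiset.count_add, Multiset.count_replicate, Multiset.count_filter]
    rcases lt_trichotomy b a with hb | rfl | hb
    · simp [hb, hb.ne']
    · simp
    · have : b ∉ M := fun hm => absurd (h b hm) (not_le.2 hb)
      simp [hb.not_gt, hb.ne, this]

/-- Lowering a single largest entry at the front of a sorted list and straightening. -/
theorem Straight.sub_one_cons {q : ℝ} {n : ℕ} {F : List ℤ → ℂ} (hF : Straight q n F) {a : ℤ}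
    {M : Multiset ℤ} (hM : ∀ b ∈ M, b ≤ a) (hn : M.card + 1 = n) :
    F ((a - 1) :: sortDesc M) = q ^ (M.count a) * F (sortDesc ((a - 1) ::ₘ M)) := by
  have h0 := sortDesc_eq_replicate_append hM
  have hlen := congrArg List.length h0
  rw [Multiset.length_sort, List.length_append, List.length_replicate] at hlen
  rw [h0, hF.replicate a _ _ (by omega)]
  congr 2
  symm
  have hM' : ∀ b ∈ (a - 1) ::ₘ M, b ≤ a := by
    intro b hb
    rcases Multiset.mem_cons.1 hb with rfl | hb
    · omega
    · exact hM b hb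
  rw [sortDesc_eq_replicate_append hM', Multiset.count_cons_of_ne (by omega),
    Multiset.filter_cons_of_pos _ (by omega), sortDesc_cons]
  intro b hb
  have := (Multiset.mem_filter.1 hb).2
  omega

theorem card_lower {M T : Multiset ℤ} (h : T ≤ M) : (lower M T).card = M.card := by
  rw [lower, Multiset.card_add, Multiset.card_map, Multiset.card_sub h]
  have := Multiset.card_le_card h
  omega

/-- Induction on the list, whose head `a` is a largest entry. If `a` is kept, it stays in front
after sorting the tail. If it is lowered, it has to pass the copies of `a` left in the tail, which
costs `q ^ (k - s)` when `s` of the `k` copies there are lowered. The two contributions add up by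
the `q`-Pascal rule. -/
theorem lowerSum_eq {q : ℝ} (hq0 : 0 < q) (hq1 : q < 1) (L : List ℤ) (hL : L.Pairwise (· ≥ ·))
    {n : ℕ} (hn : L.length = n) {F : List ℤ → ℂ} (hF : Straight q n F) (T : Multiset ℤ) :
    lowerSum F L T = stripCoeff q L T * F (sortDesc (lower L T)) := by
  induction L generalizing n F T with
  | nil =>
    rw [lowerSum]
    split_ifs with h
    · subst h
      simp [stripCoeff, lower]
    · rw [stripCoeff_eq_zero q (by simpa using h)]
      simp
  | cons a L ih =>
    obtain ⟨m, rfl⟩ : ∃ m, n = m + 1 := ⟨L.length, by simp [← hn]⟩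
    have hm : L.length = m := by simpa using hn
    obtain ⟨haL, hL'⟩ := List.pairwise_cons.1 hL
    have haL' : ∀ b ∈ (L : Multiset ℤ), b ≤ a := haL
    have hfst : (stripCoeff q L T : ℂ) * F (a :: sortDesc (lower L T)) =
        stripCoeff q L T * F (sortDesc (lower (a :: L : List ℤ) T)) := by
      by_cases hT : T ≤ (L : Multiset ℤ)
      · congr 2
        rw [← sortDesc_cons fun b => mem_lower_le haL' hT, lower, lower, ← Multiset.cons_coe,
          Multiset.cons_sub_of_le _ hT, Multiset.cons_add]
      · simp [stripCoeff_eq_zero q hT]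
    rw [lowerSum, ih hL' hm (hF.cons a), hfst]
    split_ifs with ha
    · obtain ⟨U, rfl⟩ := Multiset.exists_cons_of_mem ha
      set s := U.count a with hs
      set k := (L : Multiset ℤ).count a with hk
      rw [Multiset.erase_cons_head, ih hL' hm (hF.cons (a - 1))]
      have hsnd : (stripCoeff q L U : ℂ) * F ((a - 1) :: sortDesc (lower L U)) =
          stripCoeff q L U * (q ^ (k - s) * F (sortDesc (lower (a :: L : List ℤ) (a ::ₘ U)))) := by
        by_cases hU : U ≤ (L : Multiset ℤ)
        · congr 1
          rw [hF.sub_one_cons (fun b => mem_lower_le haL' hU)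
            (by rw [card_lower hU]; simpa using hm)]
          congr 3
          -- No entry of the tail exceeds `a`, so lowering creates no new copies of `a` and exactly
          -- `k - s` remain.
          · rw [lower, Multiset.count_add, Multiset.count_sub, count_map_sub_one,
              Multiset.count_eq_zero_of_notMem (a := a + 1), add_zero]
            intro h
            have := haL' _ (Multiset.mem_of_le hU h)
            omega
          · rw [lower, lower, ← Multiset.cons_coe, Multiset.map_cons, Multiset.add_cons,
              Multiset.sub_cons, Multiset.erase_cons_head]
        · simp [stripCoeff_eq_zero q hU]
      rw [hsnd, ← mul_assoc, ← add_mul]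
      congr 1
      norm_cast
      -- Over a common index set the three coefficients differ only in the factor at `a`.
      have hin : a ∈ (a ::ₘ U).toFinset := by simp
      rw [stripCoeff_eq_prod q L (s := (a ::ₘ U).toFinset) (T := U)
        (Multiset.toFinset_subset.2 (Multiset.subset_cons U a)), stripCoeff, stripCoeff,
        ← Finset.mul_prod_erase _ _ hin, ← Finset.mul_prod_erase _ _ hin,
        ← Finset.mul_prod_erase _ _ hin]
      have e1 : ∏ b ∈ (a ::ₘ U).toFinset.erase a, qBinom q ((L : Multiset ℤ).count b) (U.count b) =
          ∏ b ∈ (a ::ₘ U).toFinset.erase a,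
            qBinom q ((L : Multiset ℤ).count b) ((a ::ₘ U).count b) :=
        Finset.prod_congr rfl fun b hb => by
          rw [Multiset.count_cons_of_ne (Finset.ne_of_mem_erase hb)]
      have e2 : ∏ b ∈ (a ::ₘ U).toFinset.erase a,
            qBinom q (((a :: L : List ℤ) : Multiset ℤ).count b) ((a ::ₘ U).count b) =
          ∏ b ∈ (a ::ₘ U).toFinset.erase a,
            qBinom q ((L : Multiset ℤ).count b) ((a ::ₘ U).count b) :=
        Finset.prod_congr rfl fun b hb => by
          rw [← Multiset.cons_coe, Multiset.count_cons_of_ne (Finset.ne_of_mem_erase hb)]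
      rw [e1, e2, ← Multiset.cons_coe, Multiset.count_cons_self, Multiset.count_cons_self,
        ← hs, ← hk, qBinom_succ_succ hq0 hq1]
      ring
    · rw [add_zero]
      congr 2
      refine Finset.prod_congr rfl fun b hb => ?_
      rw [← Multiset.cons_coe, Multiset.count_cons_of_ne]
      rintro rfl
      exact ha (by simpa using hb)

/-! ### Sums over all ways to lower entries -/

theorem lowerSum_eq_zero (F : List ℤ → ℂ) {L : List ℤ} {T : Multiset ℤ}
    (h : ¬ T ≤ (L : Multiset ℤ)) : lowerSum F L T = 0 := by
  induction L generalizing F T with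
  | nil =>
    rw [lowerSum, if_neg]
    simpa using h
  | cons a L ih =>
    rw [lowerSum, ih _ fun h' => h (h'.trans (Multiset.le_cons_self _ a)), zero_add]
    split_ifs with ha
    · refine ih _ fun h' => h ?_
      rw [← Multiset.cons_coe]
      exact Multiset.erase_le_iff_le_cons.1 h'
    · rfl

theorem lowerSum_sum {ι : Type*} (s : Finset ι) (c : ι → ℂ) (G : ι → List ℤ → ℂ) (L : List ℤ)
    (T : Multiset ℤ) :
    lowerSum (fun K => ∑ i ∈ s, c i * G i K) L T = ∑ i ∈ s, c i * lowerSum (G i) L T := by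
  induction L generalizing G T with
  | nil =>
    simp only [lowerSum]
    split_ifs <;> simp
  | cons a L ih =>
    simp only [lowerSum, ih]
    split_ifs
    · simp [mul_add, Finset.sum_add_distrib]
    · simp

theorem lowerSum_const_mul (c : ℂ) (G : List ℤ → ℂ) (L : List ℤ) (T : Multiset ℤ) :
    lowerSum (fun K => c * G K) L T = c * lowerSum G L T := by
  simpa using lowerSum_sum (Finset.univ : Finset Unit) (fun _ => c) (fun _ => G) L T

/-- The plane wave `∏ y_j ^ {x_j}`. -/
def wave (ys : List ℂ) (L : List ℤ) : ℂ := (List.zipWith (fun y a => y ^ a) ys L).prod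

theorem wave_cons (y : ℂ) (ys : List ℂ) (a : ℤ) (L : List ℤ) :
    wave (y :: ys) (a :: L) = y ^ a * wave ys L := by simp [wave]

/-- Lowering the exponent of `y` by one multiplies the wave by `y⁻¹`, so the choice at the head
matches the recursion of `e_(r+1)` according to whether its first variable occurs. Grouping the
choices by `T` loses nothing, because `lowerSum` already counts all positions that give the same
`T`. -/
theorem sum_lowerSum_wave (ys : List ℂ) (hy : ∀ y ∈ ys, y ≠ 0) (L : List ℤ)
    (hL : L.length = ys.length) (r : ℕ) :
    ∑ T ∈ (Multiset.powersetCard r (L : Multiset ℤ)).toFinset, lowerSum (wave ys) L T =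
      ((ys : Multiset ℂ).map (·⁻¹)).esymm r * wave ys L := by
  induction ys generalizing L r with
  | nil =>
    obtain rfl : L = [] := List.length_eq_zero_iff.1 hL
    cases r with
    | zero => simp [lowerSum, Multiset.esymm]
    | succ r => simp [Multiset.esymm, Multiset.powersetCard_zero_right]
  | cons y ys ih =>
    cases L with
    | nil => simp at hL
    | cons a L =>
      have hy0 : y ≠ 0 := hy y (by simp)
      have ih' := ih (fun z hz => hy z (by simp [hz])) L (by simpa using hL)
      have hshift : y ^ (a - 1) = y ^ a * y⁻¹ := by rw [zpow_sub_one₀ hy0]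
      cases r with
      | zero =>
        have := ih' 0
        simp only [Multiset.powersetCard_zero_left, Multiset.toFinset_singleton,
          Finset.sum_singleton, Multiset.esymm, Multiset.map_singleton, Multiset.prod_zero,
          Multiset.sum_singleton, one_mul] at this ⊢
        simp [lowerSum, wave_cons, lowerSum_const_mul, this]
      | succ r =>
        simp only [lowerSum, wave_cons, lowerSum_const_mul, Finset.sum_add_distrib]
        have h1 : ∑ T ∈ (Multiset.powersetCard (r + 1) ((a :: L : List ℤ) : Multiset ℤ)).toFinset,
            y ^ a * lowerSum (wave ys) L T =
            y ^ a * (((ys : Multiset ℂ).map (·⁻¹)).esymm (r + 1) * wave ys L) := by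
          rw [← ih' (r + 1), Finset.mul_sum]
          symm
          refine Finset.sum_subset ?_ ?_
          · intro T hT
            simp only [Multiset.mem_toFinset, Multiset.mem_powersetCard] at hT ⊢
            exact ⟨hT.1.trans (Multiset.le_cons_self _ a), hT.2⟩
          · intro T hT hT'
            simp only [Multiset.mem_toFinset, Multiset.mem_powersetCard] at hT hT'
            rw [lowerSum_eq_zero _ fun h => hT' ⟨h, hT.2⟩, mul_zero]
        -- The terms in which the head is lowered are reindexed by removing one `a` from `T`.
        have h2 : ∑ T ∈ (Multiset.powersetCard (r + 1) ((a :: L : List ℤ) : Multiset ℤ)).toFinset,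
            (if a ∈ T then y ^ (a - 1) * lowerSum (wave ys) L (T.erase a) else 0) =
            y ^ (a - 1) * (((ys : Multiset ℂ).map (·⁻¹)).esymm r * wave ys L) := by
          rw [← ih' r, Finset.mul_sum, ← Finset.sum_filter]
          refine Finset.sum_nbij' (fun T => T.erase a) (fun T => a ::ₘ T) ?_ ?_ ?_ ?_ ?_
          · intro T hT
            simp only [Finset.mem_filter, Multiset.mem_toFinset, Multiset.mem_powersetCard] at hT ⊢
            refine ⟨Multiset.erase_le_iff_le_cons.2 hT.1.1, ?_⟩
            rw [Multiset.card_erase_of_mem hT.2, hT.1.2]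
            rfl
          · intro T hT
            simp only [Finset.mem_filter, Multiset.mem_toFinset, Multiset.mem_powersetCard] at hT ⊢
            refine ⟨⟨?_, by simp [hT.2]⟩, by simp⟩
            rw [← Multiset.cons_coe]
            exact Multiset.cons_le_cons a hT.1
          · intro T hT
            exact Multiset.cons_erase (Finset.mem_filter.1 hT).2
          · intro T _
            exact Multiset.erase_cons_head a T
          · intro T _
            rfl
        rw [h1, h2, ← Multiset.cons_coe, Multiset.map_cons, hshift]
        simp only [Multiset.esymm, Multiset.powersetCard_cons, Multiset.map_add, Multiset.sum_add,
          Multiset.map_map, Function.comp_def, Multiset.prod_cons, Multiset.sum_map_mul_left]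
        ring

/-! ### Operators in terms of the multiset of components -/

/-- The multiset of the components of `x`. -/
def parts {n : ℕ} (x : Dominant n) : Multiset ℤ := Finset.univ.val.map x.1

theorem count_parts {n : ℕ} (l : ℤ) (x : Dominant n) : (parts x).count l = mult l x := by
  rw [parts, Multiset.count_map, mult, Finset.card_def, Finset.filter_val]
  simp only [eq_comm]

theorem parts_eq_ofFn {n : ℕ} (x : Dominant n) : parts x = (List.ofFn x.1 : Multiset ℤ) := by
  rw [parts, Fin.univ_val_map]

theorem parts_insertPart {n : ℕ} (l : ℤ) (x : Dominant n) :
    parts (insertPart l x) = l ::ₘ parts x := by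
  rw [parts, insertPart]
  dsimp only
  generalize (⟨pos l x, Nat.lt_succ_of_le (pos_le l x)⟩ : Fin (n + 1)) = p
  rw [Fin.univ_succAbove n p]
  simp [parts, Function.comp_def]

theorem parts_deletePart {n : ℕ} (l : ℤ) (x : Dominant (n + 1)) (h : 0 < mult l x) :
    parts (deletePart l x h) = (parts x).erase l := by
  have hl := Finset.min'_mem _ (Finset.card_pos.mp h)
  rw [parts, deletePart, parts]
  dsimp only
  generalize (Finset.univ.filter fun j => x.1 j = l).min' (Finset.card_pos.mp h) = p at hl
  rw [Fin.univ_succAbove n p]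
  have : x.1 p = l := by simpa using hl
  simp [this, Function.comp_def]

/-- The operator that lowers one component `l + 1` to `l`, on functions of multisets. -/
def hopFun (q : ℝ) (l : ℤ) (g : Multiset ℤ → ℂ) (M : Multiset ℤ) : ℂ :=
  qNum q (M.count (l + 1)) * g (l ::ₘ M.erase (l + 1))

theorem hop_comp_parts (q : ℝ) (n : ℕ) (l : ℤ) (g : Multiset ℤ → ℂ) :
    hop q l n (g ∘ parts) = hopFun q l g ∘ parts := by
  funext x
  cases n with
  | zero =>
    have : parts x = 0 := by simp [parts]
    simp [hop, hopFun, this]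
  | succ n =>
    simp only [hop, LinearMap.comp_apply, Function.comp_apply, hopFun, count_parts]
    by_cases h : 0 < mult (l + 1) x
    · simp [create, annihilate, h, parts_insertPart, parts_deletePart]
    · have h0 : mult (l + 1) x = 0 := by omega
      simp [create, h0]

/-- The multiset of the negatives of the components of `x`. -/
def negParts {n : ℕ} (x : Dominant n) : Multiset ℤ := (parts x).map (- ·)

theorem count_map_neg (M : Multiset ℤ) (a : ℤ) : (M.map (- ·)).count a = M.count (-a) := by
  have := Multiset.count_map_eq_count' (fun x : ℤ => -x) M neg_injective (-a)
  simpa using this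

/-- The operator `a*_k` raises a component `k` to `k + 1`; after negation this lowers `-k` to `-k -
1`. With `l = -k - 1` it becomes the lowering from `l + 1` to `l`. -/
theorem hopStar_comp_negParts (q : ℝ) (n : ℕ) (l : ℤ) (g : Multiset ℤ → ℂ) :
    hopStar q (-l - 1) n (g ∘ negParts) = hopFun q l g ∘ negParts := by
  funext x
  -- Inserting the raised component does not affect the multiplicity from which the weight is read.
  have hc : mult (-l - 1) (insertPart (-l - 1 + 1) x) = mult (-l - 1) x := by
    rw [← count_parts, ← count_parts, parts_insertPart, Multiset.count_cons_of_ne (by omega)]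
  have hn : (negParts x).count (l + 1) = mult (-l - 1) x := by
    rw [negParts, count_map_neg, ← count_parts]
    congr 1
    ring
  simp only [hopStar, LinearMap.comp_apply, Function.comp_apply, hopFun, hn]
  by_cases h : 0 < mult (-l - 1) x
  · have h' : 0 < mult (-l - 1) (insertPart (-l - 1 + 1) x) := hc ▸ h
    change (if h : _ then _ else _) = _
    rw [dif_pos h', hc]
    congr 1
    rw [Function.comp_apply, negParts, parts_deletePart, parts_insertPart,
      Multiset.erase_cons_tail _ (by omega), Multiset.map_cons,
      Multiset.map_erase _ neg_injective, negParts]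
    congr 2 <;> ring_nf
  · have h' : ¬ 0 < mult (-l - 1) (insertPart (-l - 1 + 1) x) := hc ▸ h
    change (if h : _ then _ else _) = _
    rw [dif_neg h']
    have h0 : mult (-l - 1) x = 0 := by omega
    simp [h0]

/-- `X` acts as a family of lowering operators on functions that factor through `ρ`. -/
def ActsByLowering (q : ℝ) {n : ℕ} (ρ : Dominant n → Multiset ℤ) (X : ℤ → Module.End ℂ (Fun n)) :
    Prop :=
  ∀ (l : ℤ) (g : Multiset ℤ → ℂ), X l (g ∘ ρ) = hopFun q l g ∘ ρ

section Monomials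

variable {q : ℝ} {n : ℕ} {ρ : Dominant n → Multiset ℤ} {X : ℤ → Module.End ℂ (Fun n)}

/-- Each application uses up one copy of `l + 1`, so the weights are `[m], [m-1], …`. -/
theorem ActsByLowering.pow (hX : ActsByLowering q ρ X) (l : ℤ) (c : ℕ) (g : Multiset ℤ → ℂ) :
    (X l ^ c) (g ∘ ρ) = (fun M => (qFall q (M.count (l + 1)) c : ℂ) *
      g (Multiset.replicate c l + (M - Multiset.replicate c (l + 1)))) ∘ ρ := by
  induction c with
  | zero => funext x; simp
  | succ c ih =>
    rw [pow_succ', Module.End.mul_apply, ih, hX]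
    congr 1
    funext M
    rw [hopFun, qFall_succ_left, Multiset.count_cons_of_ne (by omega), Multiset.count_erase_self]
    push_cast
    rw [mul_assoc]
    congr 3
    ext b
    simp only [Multiset.count_add, Multiset.count_sub, Multiset.count_replicate, Multiset.count_cons]
    by_cases h1 : b = l + 1
    · subst h1
      simp
      omega
    · rw [Multiset.count_erase_of_ne h1]
      split_ifs <;> omega

/-- The multiset that contains `c_k` copies of `l_k + 1` for each `k`. -/
def sources (c : List ℕ) (l : Fin c.length → ℤ) : Multiset ℤ :=
  ∑ k, Multiset.replicate (c.get k) (l k + 1)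

theorem sources_cons (m : ℕ) (c : List ℕ) (l : Fin (m :: c).length → ℤ) :
    sources (m :: c) l =
      Multiset.replicate m (l 0 + 1) + sources c (fun k => l (Fin.succ k)) :=
  Fin.sum_univ_succ _

theorem mem_sources {c : List ℕ} {l : Fin c.length → ℤ} {b : ℤ} (hb : b ∈ sources c l) :
    ∃ k, b = l k + 1 := by
  rw [sources, Multiset.mem_sum] at hb
  obtain ⟨k, -, hk⟩ := hb
  exact ⟨k, Multiset.eq_of_mem_replicate hk⟩

theorem lt_of_mem_sources_tail {m : ℕ} {c : List ℕ} {l : Fin (m :: c).length → ℤ}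
    (hl : StrictMono l) {b : ℤ} (hb : b ∈ sources c (fun k => l (Fin.succ k))) : l 0 + 1 < b := by
  obtain ⟨k, rfl⟩ := mem_sources hb
  have := hl (Fin.succ_pos k)
  change l 0 < _ at this
  omega

theorem toFinset_sources_cons {m : ℕ} (hm : 0 < m) (c : List ℕ) (l : Fin (m :: c).length → ℤ) :
    (sources (m :: c) l).toFinset =
      insert (l 0 + 1) (sources c (fun k => l (Fin.succ k))).toFinset := by
  ext b
  simp [sources_cons, hm.ne']

/-- The product over the distinct elements of `sources c l` of a function of the multiplicity. -/
theorem prod_sources_cons {R : Type*} [CommMonoid R] {m : ℕ} (hm : 0 < m) (c : List ℕ)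
    (l : Fin (m :: c).length → ℤ) (hl : StrictMono l) (w : ℤ → ℕ → R) :
    ∏ b ∈ (sources (m :: c) l).toFinset, w b ((sources (m :: c) l).count b) =
      w (l 0 + 1) m * ∏ b ∈ (sources c (fun k => l (Fin.succ k))).toFinset,
        w b ((sources c (fun k => l (Fin.succ k))).count b) := by
  have hnot : l 0 + 1 ∉ sources c (fun k => l (Fin.succ k)) := fun h =>
    lt_irrefl _ (lt_of_mem_sources_tail hl h)
  rw [toFinset_sources_cons hm, Finset.prod_insert (by simpa using hnot), sources_cons]
  congr 1
  · rw [Multiset.count_add, Multiset.count_eq_zero_of_notMem hnot]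
    simp
  · refine Finset.prod_congr rfl fun b hb => ?_
    rw [Multiset.count_add, Multiset.count_replicate, if_neg, zero_add]
    rintro rfl
    exact hnot (by simpa using hb)

theorem strictMono_tail {m : ℕ} {c : List ℕ} {l : Fin (m :: c).length → ℤ} (hl : StrictMono l) :
    StrictMono fun k => l (Fin.succ k) := fun _ _ h => hl (Fin.succ_lt_succ_iff.2 h)

/-- The first factor moves components from `l 0 + 1` to `l 0`, and all later sources exceed `l 0 +
1`. Their multiplicities are still those of the original multiset, so the weights multiply
independently. -/
theorem ActsByLowering.monomial (hX : ActsByLowering q ρ X) (c : List ℕ) (hc : ∀ m ∈ c, 0 < m)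
    (l : Fin c.length → ℤ) (hl : StrictMono l) (g : Multiset ℤ → ℂ) :
    monomial X c l (g ∘ ρ) = (fun M => ((∏ b ∈ (sources c l).toFinset,
      qFall q (M.count b) ((sources c l).count b) : ℝ) : ℂ) * g (lower M (sources c l))) ∘ ρ := by
  induction c with
  | nil =>
    funext x
    simp [QBoson.monomial, sources, lower]
  | cons m c ih =>
    have hmul : QBoson.monomial X (m :: c) l =
        X (l 0) ^ m * QBoson.monomial X c (fun k => l (Fin.succ k)) := by
      simp [QBoson.monomial, List.ofFn_succ]
    rw [hmul, Module.End.mul_apply, ih (fun k hk => hc k (by simp [hk])) _ (strictMono_tail hl),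
      hX.pow]
    congr 1
    funext M
    rw [prod_sources_cons (hc m (by simp)) c l hl fun b k => qFall q (M.count b) k,
      Complex.ofReal_mul, mul_assoc]
    congr 2
    · congr 1
      refine Finset.prod_congr rfl fun b hb => ?_
      have := lt_of_mem_sources_tail hl (Multiset.mem_toFinset.1 hb)
      rw [Multiset.count_add, Multiset.count_sub, Multiset.count_replicate,
        Multiset.count_replicate, if_neg (by omega), if_neg (by omega), zero_add, Nat.sub_zero]
    · congr 1
      rw [sources_cons, lower, lower, Multiset.map_add]
      ext b
      simp only [Multiset.count_add, Multiset.count_sub, Multiset.map_replicate,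
        Multiset.count_replicate, count_map_sub_one, add_sub_cancel_right]
      by_cases h : b = l 0
      · subst h
        have : l 0 ∉ sources c (fun k => l (Fin.succ k)) := fun h => by
          have := lt_of_mem_sources_tail hl h
          omega
        rw [Multiset.count_eq_zero_of_notMem this]
        simp
        omega
      · rw [if_neg (Ne.symm h)]
        omega

end Monomials

/-! ### Compositions with increasing labels and multisets -/

/-- The composition formed by the multiplicities of the elements of `T` in increasing order. -/
def shape (T : Multiset ℤ) : List ℕ := (T.toFinset.sort (· ≤ ·)).map fun b => T.count b

theorem sort_toFinset_sources (c : List ℕ) (hc : ∀ m ∈ c, 0 < m) (l : Fin c.length → ℤ)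
    (hl : StrictMono l) :
    (sources c l).toFinset.sort (· ≤ ·) = List.ofFn fun k => l k + 1 := by
  refine List.Perm.eq_of_pairwise (le := (· ≤ ·)) (fun a b _ _ h1 h2 => le_antisymm h1 h2)
    (Finset.pairwise_sort _ _) ?_ ?_
  · rw [List.pairwise_ofFn]
    exact fun i j h => by have := hl h; omega
  · rw [List.perm_ext_iff_of_nodup (Finset.sort_nodup _ _)
      (List.nodup_ofFn.2 fun i j h => hl.injective (by simpa using h))]
    intro b
    rw [Finset.mem_sort, Multiset.mem_toFinset, List.mem_ofFn]
    refine ⟨fun h => (mem_sources h).imp fun k hk => hk.symm, ?_⟩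
    rintro ⟨k, rfl⟩
    rw [sources, Multiset.mem_sum]
    exact ⟨k, Finset.mem_univ _, Multiset.mem_replicate.2
      ⟨(hc _ (List.get_mem c k)).ne', rfl⟩⟩

theorem count_sources (c : List ℕ) (l : Fin c.length → ℤ) (hl : StrictMono l) (k : Fin c.length) :
    (sources c l).count (l k + 1) = c.get k := by
  rw [sources, Multiset.count_sum']
  simp only [Multiset.count_replicate, add_left_inj, hl.injective.eq_iff]
  simp

theorem shape_sources (c : List ℕ) (hc : ∀ m ∈ c, 0 < m) (l : Fin c.length → ℤ)
    (hl : StrictMono l) : shape (sources c l) = c := by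
  rw [shape, sort_toFinset_sources c hc l hl, List.map_ofFn]
  simp only [Function.comp_def, count_sources c l hl]
  exact List.ofFn_get c

/-- The labels are the distinct elements of `T` in increasing order, shifted down by one. Together
with `shape_sources` and `sources_injective` this identifies pairs of a positive composition and
increasing labels with multisets. -/
theorem exists_sources_eq (T : Multiset ℤ) :
    ∃ l : Fin (shape T).length → ℤ, StrictMono l ∧ sources (shape T) l = T := by
  have hlen : (shape T).length = (T.toFinset.sort (· ≤ ·)).length := by simp [shape]
  refine ⟨fun k => (T.toFinset.sort (· ≤ ·)).get (Fin.cast hlen k) - 1, fun i j h => ?_, ?_⟩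
  · have := (Finset.sortedLT_sort T.toFinset).strictMono_get (a := Fin.cast hlen i)
      (b := Fin.cast hlen j) h
    simpa using this
  · have h1 : ∀ k : Fin (shape T).length,
        Multiset.replicate ((shape T).get k)
          ((T.toFinset.sort (· ≤ ·)).get (Fin.cast hlen k) - 1 + 1) =
        (fun b => T.count b • ({b} : Multiset ℤ))
          ((T.toFinset.sort (· ≤ ·)).get (Fin.cast hlen k)) := by
      intro k
      have h : (shape T).get k =
          T.count ((T.toFinset.sort (· ≤ ·)).get (Fin.cast hlen k)) := by
        rw [List.get_eq_getElem]
        exact List.getElem_map _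
      rw [h, sub_add_cancel]
      exact (Multiset.nsmul_singleton _ _).symm
    rw [sources, Finset.sum_congr rfl fun k _ => h1 k]
    refine ((finCongr hlen).sum_comp fun k => (fun b => T.count b • ({b} : Multiset ℤ))
      ((T.toFinset.sort (· ≤ ·)).get k)).trans ?_
    have h2 := List.sum_ofFn (f := fun k => (fun b => T.count b • ({b} : Multiset ℤ))
          ((T.toFinset.sort (· ≤ ·)).get k))
    rw [← h2]
    have h3 := List.map_ofFn (f := (T.toFinset.sort (· ≤ ·)).get)
      (g := fun b => T.count b • ({b} : Multiset ℤ))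
    simp only [Function.comp_def, List.ofFn_get] at h3
    rw [← h3]
    conv_rhs => rw [← Multiset.toFinset_sum_count_nsmul_eq T]
    rw [Finset.sum, ← Multiset.sum_coe, ← Multiset.map_coe, Finset.sort_eq]

theorem sources_injective (c : List ℕ) (hc : ∀ m ∈ c, 0 < m) :
    Function.Injective fun l : {l : Fin c.length → ℤ // StrictMono l} => sources c l.1 := by
  intro l l' h
  have h1 := congrArg (fun T : Multiset ℤ => T.toFinset.sort (· ≤ ·)) h
  simp only [sort_toFinset_sources c hc _ l.2, sort_toFinset_sources c hc _ l'.2] at h1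
  have h2 := List.ofFn_injective h1
  exact Subtype.ext (funext fun k => by simpa using congrFun h2 k)

theorem finsum_sources (c : List ℕ) (hc : ∀ m ∈ c, 0 < m) (V : Multiset ℤ → ℂ)
    (s : Finset (Multiset ℤ)) (hs : ∀ T, shape T = c → V T ≠ 0 → T ∈ s) :
    ∑ᶠ l : {l : Fin c.length → ℤ // StrictMono l}, V (sources c l.1) =
      ∑ T ∈ s with shape T = c, V T := by
  rw [← finsum_mem_range (f := V) (sources_injective c hc)]
  refine finsum_mem_eq_sum_of_inter_support_eq _ ?_
  ext T
  simp only [Set.mem_inter_iff, Set.mem_range, Function.mem_support, Finset.coe_filter,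
    Set.mem_ofPred_eq]
  constructor
  · rintro ⟨⟨l, rfl⟩, h⟩
    have := shape_sources c hc l.1 l.2
    exact ⟨⟨hs _ this h, this⟩, h⟩
  · rintro ⟨⟨-, rfl⟩, h⟩
    obtain ⟨l, hl, hT⟩ := exists_sources_eq T
    exact ⟨⟨⟨l, hl⟩, hT⟩, h⟩

theorem sum_shape (T : Multiset ℤ) : (shape T).sum = T.card := by
  rw [shape, ← Multiset.sum_coe, ← Multiset.map_coe, Finset.sort_eq]
  exact Multiset.toFinset_sum_count_eq T

theorem shape_pos (T : Multiset ℤ) : ∀ m ∈ shape T, 0 < m := by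
  intro m hm
  simp only [shape, List.mem_map, Finset.mem_sort, Multiset.mem_toFinset] at hm
  obtain ⟨b, hb, rfl⟩ := hm
  exact Multiset.count_pos.2 hb

theorem prod_map_qFact_shape (q : ℝ) (T : Multiset ℤ) :
    ((shape T : Multiset ℕ).map (qFact q)).prod = ∏ b ∈ T.toFinset, qFact q (T.count b) := by
  rw [shape, ← Multiset.map_coe, Finset.sort_eq, Multiset.map_map]
  rfl

/-- Sorting the multisets of cardinality `r` by their shape. -/
theorem sum_partition_reorderings {r : ℕ} (s : Finset (Multiset ℤ)) (hs : ∀ T ∈ s, T.card = r)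
    (V : Multiset ℤ → ℂ) (q : ℝ) :
    ∑ η : r.Partition, ((partitionFact q η : ℂ)⁻¹) *
        ∑ c ∈ (reorderings η).attach, ∑ T ∈ s with shape T = c.1, V T =
      ∑ T ∈ s, ((∏ b ∈ T.toFinset, qFact q (T.count b) : ℝ) : ℂ)⁻¹ * V T := by
  have h1 : ∀ η : r.Partition, ((partitionFact q η : ℂ)⁻¹) *
      ∑ c ∈ (reorderings η).attach, ∑ T ∈ s with shape T = c.1, V T =
      ∑ T ∈ s, if (shape T : Multiset ℕ) = η.parts then
        ((partitionFact q η : ℂ)⁻¹) * V T else 0 := by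
    intro η
    rw [Finset.sum_attach (reorderings η) fun c => ∑ T ∈ s with shape T = c, V T]
    simp only [Finset.sum_filter]
    rw [Finset.sum_comm, Finset.mul_sum]
    refine Finset.sum_congr rfl fun T _ => ?_
    simp only [Finset.sum_ite_eq, mem_reorderings, mul_ite, mul_zero]
  simp only [h1]
  rw [Finset.sum_comm]
  refine Finset.sum_congr rfl fun T hT => ?_
  -- Each `T` contributes to exactly one partition, the one formed by its multiplicities.
  let η : r.Partition :=
    { parts := (shape T : Multiset ℕ)
      parts_pos := fun {m} hm => shape_pos T m (by simpa using hm)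
      parts_sum := by rw [Multiset.sum_coe, sum_shape, hs T hT] }
  rw [Finset.sum_eq_single η]
  · rw [if_pos rfl, partitionFact, prod_map_qFact_shape]
  · intro η' _ hne
    rw [if_neg]
    intro h
    exact hne (Nat.Partition.ext h.symm)
  · intro h
    exact absurd (Finset.mem_univ _) h

/-! ### The Hamiltonians as sums over submultisets -/

section Hamiltonians

variable {q : ℝ} {n : ℕ} {ρ : Dominant n → Multiset ℤ} {X : ℤ → Module.End ℂ (Fun n)}

/-- Partition, reordering and labels together encode the multiset `T` of lowered components, and
`[η]!` is the product of the `q`-factorials of its multiplicities. Dividing the falling factorials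
by it leaves `q`-binomials. -/
theorem ActsByLowering.sum_monomials (hX : ActsByLowering q ρ X) (r : ℕ) (g : Multiset ℤ → ℂ)
    (x : Dominant n) :
    ∑ η : r.Partition, ((partitionFact q η : ℂ)⁻¹) * ∑ c ∈ (reorderings η).attach,
        ∑ᶠ l : {l : Fin c.1.length → ℤ // StrictMono l},
          QBoson.monomial X c.1 l.1 (g ∘ ρ) x =
      ∑ T ∈ (Multiset.powersetCard r (ρ x)).toFinset,
        (stripCoeff q (ρ x) T : ℂ) * g (lower (ρ x) T) := by
  set V : Multiset ℤ → ℂ := fun T => ((∏ b ∈ T.toFinset,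
      qFall q ((ρ x).count b) (T.count b) : ℝ) : ℂ) * g (lower (ρ x) T) with hV
  have hV0 : ∀ T, V T ≠ 0 → T ≤ ρ x := by
    intro T hT
    by_contra h
    refine hT ?_
    rw [Multiset.le_iff_count] at h
    push Not at h
    obtain ⟨b, hb⟩ := h
    rw [hV]
    dsimp only
    rw [Finset.prod_eq_zero (i := b), Complex.ofReal_zero, zero_mul]
    · rw [Multiset.mem_toFinset, ← Multiset.count_pos]
      omega
    · exact qFall_eq_zero q hb
  have h1 : ∀ (η : r.Partition) (c : {c // c ∈ reorderings η}),
      ∑ᶠ l : {l : Fin c.1.length → ℤ // StrictMono l},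
          QBoson.monomial X c.1 l.1 (g ∘ ρ) x =
        ∑ T ∈ (Multiset.powersetCard r (ρ x)).toFinset with shape T = c.1, V T := by
    intro η c
    rw [← finsum_sources c.1 (reordering_pos η c) V]
    · refine finsum_congr fun l => ?_
      rw [hX.monomial c.1 (reordering_pos η c) l.1 l.2]
      rfl
    · intro T hT hTV
      rw [Multiset.mem_toFinset, Multiset.mem_powersetCard]
      refine ⟨hV0 T hTV, ?_⟩
      rw [← sum_shape, hT, ← Multiset.sum_coe, (mem_reorderings η c.1).1 c.2, η.parts_sum]
  simp only [h1]
  rw [sum_partition_reorderings _ fun T hT =>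
    (Multiset.mem_powersetCard.1 (Multiset.mem_toFinset.1 hT)).2]
  refine Finset.sum_congr rfl fun T _ => ?_
  simp only [hV, stripCoeff, qBinom, Finset.prod_div_distrib, Complex.ofReal_div]
  ring

end Hamiltonians

theorem hamR_comp_parts (q : ℝ) (n r : ℕ) (g : Multiset ℤ → ℂ) (x : Dominant n) :
    hamR q n r (g ∘ parts) x = ∑ T ∈ (Multiset.powersetCard r (parts x)).toFinset,
      (stripCoeff q (parts x) T : ℂ) * g (lower (parts x) T) := by
  have hX : ActsByLowering q (parts (n := n)) (fun l => hop q l n) := hop_comp_parts q n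
  rw [← hX.sum_monomials r g x]
  simp [hamR, monomialSym, opSum, LinearMap.sum_apply, Finset.sum_apply]

/-- Strictly increasing and strictly decreasing labels correspond under `l ↦ -l - 1`. -/
def strictAntiEquiv (p : ℕ) :
    {l : Fin p → ℤ // StrictMono l} ≃ {l : Fin p → ℤ // StrictAnti l} where
  toFun l := ⟨fun k => -l.1 k - 1, fun i j h => by have := l.2 h; dsimp only; omega⟩
  invFun l := ⟨fun k => -l.1 k - 1, fun i j h => by have := l.2 h; dsimp only; omega⟩
  left_inv l := by ext; simp
  right_inv l := by ext; simp

theorem hamRStar_comp_negParts (q : ℝ) (n r : ℕ) (g : Multiset ℤ → ℂ) (x : Dominant n) :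
    hamRStar q n r (g ∘ negParts) x = ∑ T ∈ (Multiset.powersetCard r (negParts x)).toFinset,
      (stripCoeff q (negParts x) T : ℂ) * g (lower (negParts x) T) := by
  have hX : ActsByLowering q (negParts (n := n)) (fun l => hopStar q (-l - 1) n) :=
    hopStar_comp_negParts q n
  rw [← hX.sum_monomials r g x]
  simp only [hamRStar, monomialSymStar, opSum, LinearMap.sum_apply, Finset.sum_apply,
    LinearMap.smul_apply, Pi.smul_apply, smul_eq_mul]
  refine Finset.sum_congr rfl fun η _ => ?_
  congr 1
  refine Finset.sum_congr rfl fun c _ => ?_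
  exact (finsum_comp_equiv (strictAntiEquiv c.1.length)).symm

/-- The sum of all lowering operators. -/
theorem finsum_hopFun {q : ℝ} (hq1 : q < 1) (g : Multiset ℤ → ℂ) (M : Multiset ℤ) :
    ∑ᶠ l : ℤ, hopFun q l g M = ∑ T ∈ (Multiset.powersetCard 1 M).toFinset,
      (stripCoeff q M T : ℂ) * g (lower M T) := by
  have h1 : (Multiset.powersetCard 1 M).toFinset =
      M.toFinset.image fun b => ({b} : Multiset ℤ) := by
    ext T
    simp [Multiset.powersetCard_one]
  rw [h1, Finset.sum_image fun a _ b _ h => Multiset.singleton_inj.1 h,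
    ← finsum_comp_equiv (Equiv.subRight (1 : ℤ))]
  rw [finsum_eq_sum_of_support_subset (s := M.toFinset)]
  · refine Finset.sum_congr rfl fun b _ => ?_
    simp [hopFun, stripCoeff, qBinom_one_right hq1, lower, add_comm,
      ← Multiset.singleton_add, Multiset.sub_singleton]
  · intro b hb
    by_contra h
    refine hb ?_
    have : b ∉ M := by simpa using h
    simp [hopFun, this]

/-! ### The Hall-Littlewood function on lists -/

/-- The phase `e^{i t}`. -/
abbrev phase (t : ℝ) : ℂ := Complex.exp (Complex.I * (t : ℂ))

theorem phase_ne_zero (t : ℝ) : phase t ≠ 0 := Complex.exp_ne_zero _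

theorem norm_phase (t : ℝ) : ‖phase t‖ = 1 := by
  rw [phase, mul_comm, Complex.norm_exp_ofReal_mul_I]

theorem phase_neg (t : ℝ) : phase (-t) = (phase t)⁻¹ := by
  rw [phase, phase, ← Complex.exp_neg]
  congr 1
  push_cast
  ring

theorem phase_sub (s t : ℝ) : phase (s - t) = phase s / phase t := by
  rw [phase, phase, phase, ← Complex.exp_sub]
  congr 1
  push_cast
  ring

/-- Equal phases differ by a multiple of `2π`, while all coordinates lie in an open interval of that
length. -/
theorem phase_injective {n : ℕ} {ξ : Fin n → ℝ} (hξ : ξ ∈ alcove n) :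
    Function.Injective fun j => phase (ξ j) := by
  intro j k h
  obtain ⟨m, hm⟩ := Complex.exp_eq_exp_iff_exists_int.1 h
  have h1 : (ξ j : ℂ) = ξ k + m * (2 * π) := by
    have := Complex.I_ne_zero
    apply mul_left_cancel₀ this
    rw [hm]
    ring
  have h2 : ξ j = ξ k + m * (2 * π) := by exact_mod_cast h1
  have hj := hξ.2 j
  have hk := hξ.2 k
  have hπ := Real.pi_pos
  have h3 : m = 0 := by
    have ha : (m : ℝ) < 1 := by
      by_contra hc
      nlinarith
    have hb : (-1 : ℝ) < m := by
      by_contra hc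
      nlinarith
    have ha' : m < 1 := by exact_mod_cast ha
    have hb' : -1 < m := by exact_mod_cast hb
    omega
  rw [h3] at h2
  exact hξ.1.injective (by simpa using h2)

theorem wave_ofFn {n : ℕ} (y : Fin n → ℂ) (x : Fin n → ℤ) :
    wave (List.ofFn y) (List.ofFn x) = ∏ j, y j ^ x j := by
  induction n with
  | zero => simp [wave]
  | succ n ih => rw [List.ofFn_succ, List.ofFn_succ, wave_cons, ih, Fin.prod_univ_succ]

/-- The extension of the Hall-Littlewood function to arbitrary lists of integers. -/
def hallLittlewoodList (q : ℝ) {n : ℕ} (ξ : Fin n → ℝ) (L : List ℤ) : ℂ :=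
  ∑ σ : Equiv.Perm (Fin n), cFun q (fun j => ξ (σ j)) *
    wave (List.ofFn fun j => phase (ξ (σ j))) L

/-- The Hall-Littlewood function as a function of the multiset of components. -/
def hallLittlewoodMultiset (q : ℝ) {n : ℕ} (ξ : Fin n → ℝ) (M : Multiset ℤ) : ℂ :=
  hallLittlewoodList q ξ (sortDesc M)

theorem prod_phase_zpow {n : ℕ} (ξ : Fin n → ℝ) (x : Fin n → ℤ) :
    ∏ j, phase (ξ j) ^ x j = Complex.exp (Complex.I * ((∑ j, (x j : ℝ) * ξ j : ℝ) : ℂ)) := by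
  simp only [phase, ← Complex.exp_int_mul]
  rw [← Complex.exp_sum]
  congr 1
  push_cast
  rw [Finset.mul_sum]
  exact Finset.sum_congr rfl fun j _ => by ring

theorem sortDesc_parts {n : ℕ} (x : Dominant n) : sortDesc (parts x) = List.ofFn x.1 :=
  sortDesc_eq (List.pairwise_ofFn.2 fun _ _ h => x.2 h.le) (parts_eq_ofFn x).symm

theorem hallLittlewoodMultiset_parts (q : ℝ) {n : ℕ} (ξ : Fin n → ℝ) :
    hallLittlewoodMultiset q ξ ∘ parts = hallLittlewood q ξ := by
  funext x
  simp only [Function.comp_apply, hallLittlewoodMultiset, hallLittlewoodList, sortDesc_parts,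
    wave_ofFn, hallLittlewood]
  exact Finset.sum_congr rfl fun σ _ => by rw [prod_phase_zpow fun j => ξ (σ j)]

/-- The factor of the `c`-function that belongs to a pair. -/
def cFactor (q : ℝ) (u v : ℂ) : ℂ := (u - q * v) / (u - v)

theorem cFun_eq_prod_pairs (q : ℝ) {n : ℕ} (ξ : Fin n → ℝ) :
    cFun q ξ = ∏ p : Fin n × Fin n with p.1 < p.2, cFactor q (phase (ξ p.1)) (phase (ξ p.2)) := by
  rw [cFun, Finset.prod_finset_product _ Finset.univ fun j => Finset.Ioi j]
  · refine Finset.prod_congr rfl fun j _ => Finset.prod_congr rfl fun k _ => ?_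
    have h1 := phase_ne_zero (ξ j)
    have h2 := phase_sub (ξ k) (ξ j)
    rw [phase] at h2
    rw [h2, cFactor, ← mul_div_mul_left _ _ h1]
    congr 1 <;> field_simp
  · simp

/-- A numerator `u - q v` cannot vanish, because `u` has modulus `1` and `q v` has modulus `q < 1`.
-/
theorem cFun_ne_zero {q : ℝ} (hq0 : 0 < q) (hq1 : q < 1) {n : ℕ} {ξ : Fin n → ℝ}
    (hξ : Function.Injective fun j => phase (ξ j)) : cFun q ξ ≠ 0 := by
  rw [cFun_eq_prod_pairs]
  refine Finset.prod_ne_zero_iff.2 fun p hp => div_ne_zero ?_ ?_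
  · intro h
    have h1 := congrArg norm (sub_eq_zero.1 h)
    rw [norm_mul, norm_phase, norm_phase, Complex.norm_real, Real.norm_of_nonneg hq0.le] at h1
    linarith
  · exact sub_ne_zero.2 fun h => (Finset.mem_filter.1 hp).2.ne (hξ h)

/-- Swapping two adjacent arguments only affects one factor of the `c`-function. -/
theorem exists_cFun_swap (q : ℝ) {n : ℕ} (ξ : Fin n → ℝ) (i k : Fin n) (hik : k.1 = i.1 + 1) :
    ∃ D : ℂ, cFun q ξ = cFactor q (phase (ξ i)) (phase (ξ k)) * D ∧
      cFun q (fun j => ξ (Equiv.swap i k j)) = cFactor q (phase (ξ k)) (phase (ξ i)) * D := by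
  have hmem : (i, k) ∈ (Finset.univ.filter fun p : Fin n × Fin n => p.1 < p.2) := by
    rw [Finset.mem_filter, Fin.lt_def]
    exact ⟨Finset.mem_univ _, by dsimp only; omega⟩
  refine ⟨_, by rw [cFun_eq_prod_pairs, ← Finset.mul_prod_erase _ _ hmem], ?_⟩
  rw [cFun_eq_prod_pairs, ← Finset.mul_prod_erase _ _ hmem]
  simp only [Equiv.swap_apply_left, Equiv.swap_apply_right]
  congr 1
  -- Since `i` and `k` are adjacent, their transposition keeps the order of every other pair.
  have hmaps : ∀ p ∈ (Finset.univ.filter fun p : Fin n × Fin n => p.1 < p.2).erase (i, k),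
      (Equiv.swap i k p.1, Equiv.swap i k p.2) ∈
        (Finset.univ.filter fun p : Fin n × Fin n => p.1 < p.2).erase (i, k) := by
    rintro ⟨a, b⟩ h
    simp only [Finset.mem_erase, Finset.mem_filter, Finset.mem_univ, true_and, ne_eq,
      Prod.mk.injEq, Equiv.swap_apply_def, Fin.lt_def, Fin.ext_iff] at h ⊢
    split_ifs <;> omega
  exact Finset.prod_nbij' (fun p => (Equiv.swap i k p.1, Equiv.swap i k p.2))
    (fun p => (Equiv.swap i k p.1, Equiv.swap i k p.2)) hmaps hmaps
    (fun p _ => by simp) (fun p _ => by simp) (fun p _ => rfl)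

theorem prod_zpow_add_single {n : ℕ} {y : Fin n → ℂ} (hy : ∀ j, y j ≠ 0) (w : Fin n → ℤ)
    (i : Fin n) : ∏ j, y j ^ (w j + if j = i then 1 else 0) = (∏ j, y j ^ w j) * y i := by
  simp only [zpow_add₀ (hy _), Finset.prod_mul_distrib]
  congr 1
  rw [Finset.prod_eq_single i] <;> simp +contextual

/-- In the terms of `σ` and `σ` times the transposition, the common factor `D` and the wave for `w`
split off; the latter is symmetric because `w i = w k`. With `u = y i`, `v = y k` and `c = cFactor
q`, what remains is `c(u,v) v + c(v,u) u = q (c(u,v) u + c(v,u) v)`, where both sides equal `q (u +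
v)`. -/
theorem hallLittlewoodList_straight_fin (q : ℝ) {n : ℕ} {ξ : Fin n → ℝ}
    (hξ : Function.Injective fun j => phase (ξ j)) (w : Fin n → ℤ) (i k : Fin n)
    (hik : k.1 = i.1 + 1) (hw : w i = w k) :
    hallLittlewoodList q ξ (List.ofFn fun j => w j + if j = k then 1 else 0) =
      q * hallLittlewoodList q ξ (List.ofFn fun j => w j + if j = i then 1 else 0) := by
  have hne : i ≠ k := fun h => by rw [h] at hik; omega
  have hsym : ∀ f : Equiv.Perm (Fin n) → ℂ,
      2 * ∑ σ, f σ = ∑ σ, (f σ + f (σ * Equiv.swap i k)) := by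
    intro f
    rw [Finset.sum_add_distrib, two_mul]
    congr 1
    exact (Equiv.sum_comp (Equiv.mulRight (Equiv.swap i k)) f).symm
  apply mul_left_cancel₀ (two_ne_zero (α := ℂ))
  rw [mul_left_comm]
  simp only [hallLittlewoodList, hsym, wave_ofFn, Finset.mul_sum]
  refine Finset.sum_congr rfl fun σ _ => ?_
  set y : Fin n → ℂ := fun j => phase (ξ (σ j)) with hy
  have hy0 : ∀ j, y j ≠ 0 := fun j => phase_ne_zero _
  obtain ⟨D, h1, h2⟩ := exists_cFun_swap q (fun j => ξ (σ j)) i k hik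
  have hws : ∏ j, y (Equiv.swap i k j) ^ w j = ∏ j, y j ^ w j := by
    rw [← Equiv.prod_comp (Equiv.swap i k) fun j => y j ^ w j]
    refine Finset.prod_congr rfl fun j _ => ?_
    congr 1
    rw [Equiv.swap_apply_def]
    split_ifs with ha hb
    · rw [ha, hw]
    · rw [hb, hw]
    · rfl
  have e3 := prod_zpow_add_single (y := fun j => y (Equiv.swap i k j)) (fun j => hy0 _) w i
  have e4 := prod_zpow_add_single (y := fun j => y (Equiv.swap i k j)) (fun j => hy0 _) w k
  simp only [hws, Equiv.swap_apply_left, Equiv.swap_apply_right] at e3 e4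
  have hne' : y i - y k ≠ 0 := sub_ne_zero.2 fun h => hne (σ.injective (hξ h))
  have hne'' : y k - y i ≠ 0 := by
    rw [← neg_sub]
    exact neg_ne_zero.2 hne'
  simp only [Equiv.Perm.mul_apply]
  rw [prod_zpow_add_single hy0, prod_zpow_add_single hy0]
  rw [show (∏ x, phase (ξ (σ ((Equiv.swap i k) x))) ^ (w x + if x = i then 1 else 0)) = _ from e3,
    show (∏ x, phase (ξ (σ ((Equiv.swap i k) x))) ^ (w x + if x = k then 1 else 0)) = _ from e4,
    h1, h2]
  change cFactor q (y i) (y k) * D * _ + cFactor q (y k) (y i) * D * _ =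
    q * (cFactor q (y i) (y k) * D * _ + cFactor q (y k) (y i) * D * _)
  have h5 : cFactor q (y k) (y i) = -(y k - q * y i) / (y i - y k) := by
    rw [cFactor, ← neg_sub (y i) (y k), div_neg, neg_div]
  rw [h5, cFactor]
  field_simp
  ring

theorem hallLittlewoodList_straight (q : ℝ) {n : ℕ} {ξ : Fin n → ℝ}
    (hξ : Function.Injective fun j => phase (ξ j)) : Straight q n (hallLittlewoodList q ξ) := by
  intro u a v h
  have hlen : (u ++ a :: a :: v).length = n := by simp; omega
  -- Both lists arise from `u, a, a, v` by adding one to one of the two middle entries.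
  have h1 := hallLittlewoodList_straight_fin q hξ
    (fun j => (u ++ a :: a :: v)[j.1]'(by omega)) ⟨u.length, by omega⟩ ⟨u.length + 1, by omega⟩
    rfl (by simp)
  convert h1 using 2
  · refine List.ext_getElem (by simp; omega) fun m hm hm' => ?_
    simp only [List.getElem_ofFn, Fin.ext_iff]
    grind
  · congr 1
    refine List.ext_getElem (by simp; omega) fun m hm hm' => ?_
    simp only [List.getElem_ofFn, Fin.ext_iff]
    grind

/-! ### The eigenvalue equations -/

theorem coe_ofFn_comp_perm {n : ℕ} {α : Type*} (f : Fin n → α) (σ : Equiv.Perm (Fin n)) :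
    ((List.ofFn fun j => f (σ j) : List α) : Multiset α) = Finset.univ.val.map f := by
  have h := congrArg (fun s => Multiset.map f s.val) (Finset.map_univ_equiv σ)
  rw [Finset.map_val, Multiset.map_map] at h
  rw [← Fin.univ_val_map]
  exact h

/-- The dual Pieri formula for the Hall-Littlewood function. -/
theorem sum_stripCoeff_mul_hallLittlewoodMultiset {q : ℝ} (hq0 : 0 < q) (hq1 : q < 1) {n : ℕ}
    {ξ : Fin n → ℝ} (hξ : ξ ∈ alcove n) (r : ℕ) (x : Dominant n) :
    ∑ T ∈ (Multiset.powersetCard r (parts x)).toFinset,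
        (stripCoeff q (parts x) T : ℂ) * hallLittlewoodMultiset q ξ (lower (parts x) T) =
      MvPolynomial.eval (fun j => phase (-ξ j)) (MvPolynomial.esymm (Fin n) ℂ r) *
        hallLittlewoodMultiset q ξ (parts x) := by
  have hstr := hallLittlewoodList_straight q (phase_injective hξ)
  have hsorted : (List.ofFn x.1).Pairwise (· ≥ ·) := List.pairwise_ofFn.2 fun _ _ h => x.2 h.le
  simp only [hallLittlewoodMultiset, sortDesc_parts]
  rw [parts_eq_ofFn]
  simp only [← lowerSum_eq hq0 hq1 _ hsorted (by simp) hstr]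
  unfold hallLittlewoodList
  simp only [lowerSum_sum]
  rw [Finset.sum_comm, Finset.mul_sum]
  refine Finset.sum_congr rfl fun σ _ => ?_
  rw [← Finset.mul_sum, sum_lowerSum_wave _ _ _ (by simp), mul_left_comm]
  · congr 1
    rw [coe_ofFn_comp_perm (fun j => phase (ξ j)), Multiset.map_map,
      ← MvPolynomial.coe_aeval_eq_eval]
    change _ = MvPolynomial.aeval _ _
    rw [MvPolynomial.aeval_esymm_eq_multiset_esymm]
    simp only [phase_neg, Function.comp_def]
  · intro y hy
    obtain ⟨j, rfl⟩ := List.mem_ofFn.1 hy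
    exact phase_ne_zero _

/-! ### Reflection and the eigenvalue equations for the operators -/

/-- The point with components `-x_n ≥ ⋯ ≥ -x_1`. -/
def negRev {n : ℕ} (x : Dominant n) : Dominant n :=
  ⟨fun j => -x.1 j.rev, fun _ _ h => neg_le_neg (x.2 (Fin.rev_le_rev.2 h))⟩

theorem parts_negRev {n : ℕ} (x : Dominant n) : parts (negRev x) = negParts x := by
  rw [negParts, parts_eq_ofFn, negRev, parts, Multiset.map_map]
  exact coe_ofFn_comp_perm (fun j => -x.1 j) Fin.revPerm

theorem neg_rev_mem_alcove {n : ℕ} {ξ : Fin n → ℝ} (hξ : ξ ∈ alcove n) :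
    (fun j => -ξ j.rev) ∈ alcove n := by
  refine ⟨fun i j h => neg_lt_neg (hξ.1 (Fin.rev_lt_rev.2 h)), fun j => ?_⟩
  have := hξ.2 j.rev
  constructor <;> linarith

/-- Negation inverts the phases, and `cFactor q u⁻¹ v⁻¹ = cFactor q v u`; reversal of the indices
undoes this exchange. -/
theorem cFun_neg_rev (q : ℝ) {n : ℕ} (ξ : Fin n → ℝ) : cFun q (fun j => -ξ j.rev) = cFun q ξ := by
  rw [cFun_eq_prod_pairs, cFun_eq_prod_pairs]
  refine Finset.prod_nbij' (fun p => (p.2.rev, p.1.rev)) (fun p => (p.2.rev, p.1.rev)) ?_ ?_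
    (fun p _ => by simp) (fun p _ => by simp) ?_
  · intro p hp
    simpa using hp
  · intro p hp
    simpa using hp
  · intro p _
    have h1 := phase_ne_zero (ξ p.1.rev)
    have h2 := phase_ne_zero (ξ p.2.rev)
    simp only [phase_neg, cFactor]
    rw [← mul_div_mul_left _ _ (mul_ne_zero h1 h2)]
    congr 1 <;> field_simp

theorem hallLittlewood_negRev (q : ℝ) {n : ℕ} (ξ : Fin n → ℝ) (x : Dominant n) :
    hallLittlewood q (fun j => -ξ j.rev) (negRev x) = hallLittlewood q ξ x := by
  simp only [hallLittlewood]
  -- Conjugating `σ` by the reversal matches the two sums term by term.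
  refine Fintype.sum_equiv (Fin.revPerm.permCongr) _ _ fun σ => ?_
  congr 1
  · rw [← cFun_neg_rev]
    simp
  · congr 3
    refine Fintype.sum_equiv Fin.revPerm _ _ fun j => ?_
    simp [negRev]

theorem hallLittlewoodMultiset_negParts (q : ℝ) {n : ℕ} (ξ : Fin n → ℝ) :
    hallLittlewoodMultiset q (fun j => -ξ j.rev) ∘ negParts = hallLittlewood q ξ := by
  funext x
  rw [← hallLittlewood_negRev, ← hallLittlewoodMultiset_parts, Function.comp_apply,
    Function.comp_apply, parts_negRev]

theorem eval_esymm_rev {n : ℕ} (f : Fin n → ℂ) (r : ℕ) :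
    MvPolynomial.eval (fun j => f j.rev) (MvPolynomial.esymm (Fin n) ℂ r) =
      MvPolynomial.eval f (MvPolynomial.esymm (Fin n) ℂ r) := by
  conv_rhs => rw [← MvPolynomial.rename_esymm (Fin n) ℂ r Fin.revPerm, MvPolynomial.eval_rename]
  rfl

/-- The dual Pieri formula for the negated components. -/
theorem sum_stripCoeff_mul_hallLittlewoodMultiset_neg {q : ℝ} (hq0 : 0 < q) (hq1 : q < 1) {n : ℕ}
    {ξ : Fin n → ℝ} (hξ : ξ ∈ alcove n) (r : ℕ) (x : Dominant n) :
    ∑ T ∈ (Multiset.powersetCard r (negParts x)).toFinset, (stripCoeff q (negParts x) T : ℂ) *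
        hallLittlewoodMultiset q (fun j => -ξ j.rev) (lower (negParts x) T) =
      MvPolynomial.eval (fun j => phase (ξ j)) (MvPolynomial.esymm (Fin n) ℂ r) *
        hallLittlewood q ξ x := by
  have h := sum_stripCoeff_mul_hallLittlewoodMultiset hq0 hq1 (neg_rev_mem_alcove hξ) r (negRev x)
  rw [parts_negRev] at h
  rw [h, ← hallLittlewoodMultiset_negParts]
  simp only [neg_neg]
  rw [eval_esymm_rev fun j => phase (ξ j)]
  rfl

theorem hamR_hallLittlewood {q : ℝ} (hq0 : 0 < q) (hq1 : q < 1) {n : ℕ} {ξ : Fin n → ℝ}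
    (hξ : ξ ∈ alcove n) (r : ℕ) :
    hamR q n r (hallLittlewood q ξ) =
      MvPolynomial.eval (fun j => phase (-ξ j)) (MvPolynomial.esymm (Fin n) ℂ r) •
        hallLittlewood q ξ := by
  funext x
  rw [← hallLittlewoodMultiset_parts, hamR_comp_parts,
    sum_stripCoeff_mul_hallLittlewoodMultiset hq0 hq1 hξ]
  rfl

theorem hamRStar_hallLittlewood {q : ℝ} (hq0 : 0 < q) (hq1 : q < 1) {n : ℕ} {ξ : Fin n → ℝ}
    (hξ : ξ ∈ alcove n) (r : ℕ) :
    hamRStar q n r (hallLittlewood q ξ) =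
      MvPolynomial.eval (fun j => phase (ξ j)) (MvPolynomial.esymm (Fin n) ℂ r) •
        hallLittlewood q ξ := by
  funext x
  rw [Pi.smul_apply, smul_eq_mul, ← sum_stripCoeff_mul_hallLittlewoodMultiset_neg hq0 hq1 hξ,
    ← hamRStar_comp_negParts, hallLittlewoodMultiset_negParts]

theorem hamiltonian_hallLittlewood {q : ℝ} (hq0 : 0 < q) (hq1 : q < 1) {n : ℕ} {ξ : Fin n → ℝ}
    (hξ : ξ ∈ alcove n) :
    hamiltonian q n (hallLittlewood q ξ) =
      ((2 * ∑ j, Real.cos (ξ j) : ℝ) : ℂ) • hallLittlewood q ξ := by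
  funext x
  have h1 : ∑ᶠ l : ℤ, hop q l n (hallLittlewood q ξ) x =
      (∑ j, phase (-ξ j)) * hallLittlewood q ξ x := by
    have h := sum_stripCoeff_mul_hallLittlewoodMultiset hq0 hq1 hξ 1 x
    rw [← finsum_hopFun hq1, MvPolynomial.esymm_one, map_sum] at h
    simp only [MvPolynomial.eval_X] at h
    rw [← hallLittlewoodMultiset_parts]
    simp only [hop_comp_parts]
    exact h
  have h2 : ∑ᶠ l : ℤ, hopStar q l n (hallLittlewood q ξ) x =
      (∑ j, phase (ξ j)) * hallLittlewood q ξ x := by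
    have h := sum_stripCoeff_mul_hallLittlewoodMultiset_neg hq0 hq1 hξ 1 x
    rw [← finsum_hopFun hq1, MvPolynomial.esymm_one, map_sum] at h
    simp only [MvPolynomial.eval_X] at h
    rw [← h, ← hallLittlewoodMultiset_negParts,
      ← finsum_comp_equiv ((Equiv.neg ℤ).trans (Equiv.subRight (1 : ℤ)))]
    refine finsum_congr fun l => ?_
    exact congrFun (hopStar_comp_negParts q n l _) x
  have h3 : hamiltonian q n (hallLittlewood q ξ) x =
      ∑ᶠ l : ℤ, (hop q l n (hallLittlewood q ξ) x + hopStar q l n (hallLittlewood q ξ) x) := rfl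
  rw [h3, finsum_add_distrib ((hop_locallyFinite q n).support _ x)
    ((hopStar_locallyFinite q n).support _ x), h1, h2, ← add_mul, Pi.smul_apply, smul_eq_mul,
    ← Finset.sum_add_distrib]
  congr 1
  push_cast
  rw [Finset.mul_sum]
  refine Finset.sum_congr rfl fun j _ => ?_
  rw [Complex.two_cos, phase, phase, add_comm]
  congr 2 <;> push_cast <;> ring

/-! ### The Hall-Littlewood function does not vanish -/

/-- The additive monoid of weakly decreasing tuples. -/
def dominantSubmonoid (n : ℕ) : AddSubmonoid (Fin n → ℤ) where
  carrier := {x | Antitone x}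
  add_mem' hx hy := hx.add hy
  zero_mem' := antitone_const

/-- The plane wave with wave vector `y` as a character of the monoid of dominant tuples. -/
def waveHom {n : ℕ} (y : Fin n → ℂ) (hy : ∀ j, y j ≠ 0) :
    Multiplicative (dominantSubmonoid n) →* ℂ where
  toFun x := ∏ j, y j ^ (x.toAdd.1 j)
  map_one' := by simp
  map_mul' x z := by
    rw [← Finset.prod_mul_distrib]
    exact Finset.prod_congr rfl fun j _ => zpow_add₀ (hy j) _ _

/-- Indicators of initial segments are weakly decreasing, so the partial products of `y` and `z`
agree; quotients of consecutive ones recover the entries. -/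
theorem eq_of_waveHom_eq {n : ℕ} {y z : Fin n → ℂ} (hy : ∀ j, y j ≠ 0) (hz : ∀ j, z j ≠ 0)
    (h : waveHom y hy = waveHom z hz) : y = z := by
  have key : ∀ s : Finset (Fin n), (∀ i j, i ≤ j → j ∈ s → i ∈ s) →
      ∏ j ∈ s, y j = ∏ j ∈ s, z j := by
    intro s hs
    let x : dominantSubmonoid n := ⟨fun j => if j ∈ s then 1 else 0, fun i j hij => by
      by_cases hj : j ∈ s
      · simp [hj, hs i j hij hj]
      · simp only [hj, if_false]
        split_ifs <;> simp⟩
    have h1 := DFunLike.congr_fun h (Multiplicative.ofAdd x)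
    simpa [waveHom, x, Finset.prod_ite] using h1
  funext k
  have h1 := key (Finset.Iic k) fun i j hij hj => by
    rw [Finset.mem_Iic] at hj ⊢
    exact hij.trans hj
  have h2 := key (Finset.Iio k) fun i j hij hj => by
    rw [Finset.mem_Iio] at hj ⊢
    exact hij.trans_lt hj
  rw [← Finset.Iio_insert, Finset.prod_insert (by simp), Finset.prod_insert (by simp), h2] at h1
  exact mul_right_cancel₀ (Finset.prod_ne_zero_iff.2 fun j _ => hz j) h1

/-- The phases are distinct, so different permutations give different characters, and these are
linearly independent. A vanishing sum would force `C(ξ)`, the coefficient at `σ = 1`, to be zero. -/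
theorem hallLittlewood_ne_zero {q : ℝ} (hq0 : 0 < q) (hq1 : q < 1) {n : ℕ} {ξ : Fin n → ℝ}
    (hξ : ξ ∈ alcove n) : hallLittlewood q ξ ≠ 0 := by
  have hinj := phase_injective hξ
  let χ : Equiv.Perm (Fin n) → (Multiplicative (dominantSubmonoid n) →* ℂ) := fun σ =>
    waveHom (fun j => phase (ξ (σ j))) fun _ => phase_ne_zero _
  have hχ : Function.Injective χ := fun σ τ h => Equiv.ext fun j =>
    hinj (congrFun (eq_of_waveHom_eq _ _ h) j)
  have hlin := Fintype.linearIndependent_iff.1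
    ((linearIndependent_monoidHom (Multiplicative (dominantSubmonoid n)) ℂ).comp χ hχ)
    (fun σ => cFun q fun j => ξ (σ j))
  intro h0
  refine cFun_ne_zero hq0 hq1 hinj (hlin ?_ 1)
  funext x
  have h1 := congrFun h0 ⟨x.toAdd.1, x.toAdd.2⟩
  simp only [hallLittlewood, Pi.zero_apply] at h1
  rw [Finset.sum_apply, Pi.zero_apply, ← h1]
  refine Finset.sum_congr rfl fun σ _ => ?_
  rw [← prod_phase_zpow fun j => ξ (σ j)]
  rfl

end

end QBoson

theorem corollary3 (q : ℝ) (hq0 : 0 < q) (hq1 : q < 1) (n : ℕ) (ξ : Fin n → ℝ)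
    (hξ : ξ ∈ QBoson.alcove n) :
    (∀ r : ℕ, 1 ≤ r → r ≤ n →
      Module.End.HasEigenvector (QBoson.hamR q n r)
        (MvPolynomial.eval (fun j => Complex.exp (-(Complex.I * (ξ j : ℂ))))
          (MvPolynomial.esymm (Fin n) ℂ r))
        (QBoson.hallLittlewood q ξ) ∧
      Module.End.HasEigenvector (QBoson.hamRStar q n r)
        (MvPolynomial.eval (fun j => Complex.exp (Complex.I * (ξ j : ℂ)))
          (MvPolynomial.esymm (Fin n) ℂ r))
        (QBoson.hallLittlewood q ξ)) ∧
    Module.End.HasEigenvector (QBoson.hamiltonian q n)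
      ((2 * ∑ j, Real.cos (ξ j) : ℝ) : ℂ)
      (QBoson.hallLittlewood q ξ) := by
  have hne := QBoson.hallLittlewood_ne_zero hq0 hq1 hξ
  refine ⟨fun r _ _ => ⟨⟨?_, hne⟩, ⟨?_, hne⟩⟩, ⟨?_, hne⟩⟩
  · rw [Module.End.mem_eigenspace_iff, QBoson.hamR_hallLittlewood hq0 hq1 hξ]
    simp only [QBoson.phase, Complex.ofReal_neg, mul_neg]
  · rw [Module.End.mem_eigenspace_iff, QBoson.hamRStar_hallLittlewood hq0 hq1 hξ]
  · rw [Module.End.mem_eigenspace_iff, QBoson.hamiltonian_hallLittlewood hq0 hq1 hξ]
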